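/- **Theorem 7.1 (Relative products in ProbAlg).** A *probability algebra* $X=(\mathcal B_X,\mu_X)$ is a $\sigma$-complete Boolean algebra $\mathcal B_X$ with a countably additive $\mu_X:\mathcal B_X\to[0,1]$ such that $\mu_X(0)=0$, $\mu_X(1)=1$ and $\mu_X(E)>0$ for all $E\neq 0$. A *morphism* $\pi:X\to Y$ is a measure-preserving Boolean homomorphism $\pi^*:\mathcal B_Y\to\mathcal B_X$ that preserves countable meets and joins. $L^\infty(X)$ is the $*$-algebra of bounded abstractly measurable functions on $X$, that is, of homomorphisms $f$ from the Borel $\sigma$-algebra of $\mathbb C$ to $\mathcal B_X$ that preserve countable meets and joins and satisfy $f(\{|z|\le M\})=1$ for some $M$; write $\int_X f=\int_{\mathbb C} z\,d(\mu_X\circ f)(z)$. A morphism $\pi:X\to Y$ induces the $*$-homomorphism $L^\infty(\pi):L^\infty(Y)\to L^\infty(X)$, $g\mapsto \pi^*\circ g$, and for $f\in L^\infty(X)$ the conditional expectation $\mathbb E(f|Y)$ is the unique element of $L^\infty(Y)$ with $\int_X f\cdot L^\infty(\pi)(g)=\int_Y \mathbb E(f|Y)\,g$ for all $g\in L^\infty(Y)$.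 Let $\pi_1:X_1\to Y$ and $\pi_2:X_2\to Y$ be morphisms of probability algebras. Then there exist a probability algebra $X_1\otimes_Y X_2$ and morphisms $\Pi_1:X_1\otimes_Y X_2\to X_1$, $\Pi_2:X_1\otimes_Y X_2\to X_2$ such that: 1. $\pi_1\circ\Pi_1=\pi_2\circ\Pi_2$, and hence also $L^\infty(\Pi_1)\circ L^\infty(\pi_1)=L^\infty(\Pi_2)\circ L^\infty(\pi_2)$; 2. for all $f_1\in L^\infty(X_1)$ and $f_2\in L^\infty(X_2)$, the conditional expectations exist and $$\int_{X_1\otimes_Y X_2} L^\infty(\Pi_1)(f_1)\,L^\infty(\Pi_2)(f_2)=\int_Y \mathbb E(f_1|Y)\,\mathbb E(f_2|Y);$$ 3. $\mathcal B_{X_1\otimes_Y X_2}$ is generated, as a $\sigma$-complete Boolean algebra, by $\Pi_1^*(\mathcal B_{X_1})\cup\Pi_2^*(\mathcal B_{X_2})$. -/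

import Mathlib

open CategoryTheory MeasureTheory Set

universe u

/-! ### Sigma-complete Boolean algebras and their morphisms -/

/-- Homomorphisms of Boolean algebras which preserve countable joins. (They commute with
complements, so they preserve countable meets as well, see `SigmaHom.map_isGLB`.) -/
structure SigmaHom (A B : Type*) [BooleanAlgebra A] [BooleanAlgebra B]
    extends BoundedLatticeHom A B where
  map_isLUB' : ∀ (E : ℕ → A) (s : A), IsLUB (range E) s →
    IsLUB (range fun n => toFun (E n)) (toFun s)

/-- The measurable subsets of `α`, as an abstract Boolean algebra. -/
abbrev MeasSet (α : Type*) [MeasurableSpace α] : Type _ :=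
  Subtype (MeasurableSet : Set α → Prop)

/-- The abstract sigma-algebra of Borel subsets of the complex plane. -/
abbrev BorelC : Type := MeasSet ℂ

namespace SigmaHom

variable {A B C : Type*} [BooleanAlgebra A] [BooleanAlgebra B] [BooleanAlgebra C]

instance : FunLike (SigmaHom A B) A B where
  coe f := f.toFun
  coe_injective := by
    rintro ⟨f, _⟩ ⟨g, _⟩ h
    have : f = g := DFunLike.coe_injective h
    subst this
    rfl

instance : BoundedLatticeHomClass (SigmaHom A B) A B where
  map_sup f := f.map_sup'
  map_inf f := f.map_inf'
  map_top f := f.map_top'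
  map_bot f := f.map_bot'

@[ext]
theorem ext {f g : SigmaHom A B} (h : ∀ a, f a = g a) : f = g :=
  DFunLike.ext f g h

theorem map_isLUB (f : SigmaHom A B) {E : ℕ → A} {s : A} (h : IsLUB (range E) s) :
    IsLUB (range fun n => f (E n)) (f s) :=
  f.map_isLUB' E s h

theorem isLUB_compl {A : Type*} [BooleanAlgebra A] {E : ℕ → A} {s : A}
    (h : IsGLB (range E) s) : IsLUB (range fun n => (E n)ᶜ) sᶜ := by
  refine ⟨?_, ?_⟩
  · rintro _ ⟨n, rfl⟩
    exact compl_le_compl (h.1 ⟨n, rfl⟩)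
  · intro b hb
    refine compl_le_of_compl_le (h.2 ?_)
    rintro _ ⟨n, rfl⟩
    exact compl_le_of_compl_le (hb ⟨n, rfl⟩)

theorem isGLB_compl {A : Type*} [BooleanAlgebra A] {E : ℕ → A} {s : A}
    (h : IsLUB (range E) s) : IsGLB (range fun n => (E n)ᶜ) sᶜ := by
  refine ⟨?_, ?_⟩
  · rintro _ ⟨n, rfl⟩
    exact compl_le_compl (h.1 ⟨n, rfl⟩)
  · intro b hb
    refine le_compl_comm.1 (h.2 ?_)
    rintro _ ⟨n, rfl⟩
    exact le_compl_comm.1 (hb ⟨n, rfl⟩)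

theorem map_isGLB (f : SigmaHom A B) {E : ℕ → A} {s : A} (h : IsGLB (range E) s) :
    IsGLB (range fun n => f (E n)) (f s) := by
  have := isGLB_compl (f.map_isLUB (isLUB_compl h))
  simpa [map_compl'] using this

/-- The identity. -/
protected def id (A : Type*) [BooleanAlgebra A] : SigmaHom A A where
  toBoundedLatticeHom := BoundedLatticeHom.id A
  map_isLUB' _ _ h := h

/-- Composition. -/
def comp (g : SigmaHom B C) (f : SigmaHom A B) : SigmaHom A C where
  toBoundedLatticeHom := g.toBoundedLatticeHom.comp f.toBoundedLatticeHom
  map_isLUB' _ _ h := g.map_isLUB (f.map_isLUB h)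

@[simp] theorem id_apply (a : A) : SigmaHom.id A a = a := rfl

@[simp] theorem comp_apply (g : SigmaHom B C) (f : SigmaHom A B) (a : A) :
    g.comp f a = g (f a) := rfl

end SigmaHom

/-- Countable joins of measurable sets are unions. -/
theorem MeasSet.isLUB_iff {α : Type*} [MeasurableSpace α] {E : ℕ → MeasSet α} {s : MeasSet α} :
    IsLUB (range E) s ↔ (s : Set α) = ⋃ n, (E n : Set α) := by
  have key : IsLUB (range E) ⟨⋃ n, (E n : Set α), MeasurableSet.iUnion fun n => (E n).2⟩ := by
    refine ⟨?_, ?_⟩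
    · rintro _ ⟨n, rfl⟩
      exact subset_iUnion (fun n => (E n : Set α)) n
    · intro b hb
      exact iUnion_subset fun n => hb ⟨n, rfl⟩
  constructor
  · intro h
    exact congrArg Subtype.val (h.unique key)
  · intro h
    have : s = ⟨⋃ n, (E n : Set α), MeasurableSet.iUnion fun n => (E n).2⟩ := Subtype.ext h
    rw [this]
    exact key

theorem MeasSet.isLUB_iUnion {α : Type*} [MeasurableSpace α] (t : ℕ → Set α)
    (ht : ∀ n, MeasurableSet (t n)) (h : MeasurableSet (⋃ n, t n)) :
    IsLUB (range fun n => (⟨t n, ht n⟩ : MeasSet α)) ⟨⋃ n, t n, h⟩ :=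
  MeasSet.isLUB_iff.2 rfl

/-- Preimage under a measurable map. -/
def MeasSet.preimage {α β : Type*} [MeasurableSpace α] [MeasurableSpace β] (φ : α → β)
    (hφ : Measurable φ) : SigmaHom (MeasSet β) (MeasSet α) where
  toFun E := ⟨φ ⁻¹' (E : Set β), hφ E.2⟩
  map_sup' _ _ := rfl
  map_inf' _ _ := rfl
  map_top' := rfl
  map_bot' := rfl
  map_isLUB' E s h := by
    rw [MeasSet.isLUB_iff] at h ⊢
    simp [h]

/-- The subset of a Boolean algebra is closed under complements and countable joins. -/
structure IsSigmaSubalgebra {A : Type*} [BooleanAlgebra A] (S : Set A) : Prop where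
  bot_mem : ⊥ ∈ S
  compl_mem : ∀ a ∈ S, aᶜ ∈ S
  isLUB_mem : ∀ (E : ℕ → A) (s : A), (∀ n, E n ∈ S) → IsLUB (range E) s → s ∈ S

/-! ### The category of probability algebras -/

/-- Probability algebras: sigma-complete Boolean algebras with a countably additive probability
measure that is positive on the non-zero elements. -/
structure ProbAlg : Type (u + 1) where
  carrier : Type u
  [boolAlg : BooleanAlgebra carrier]
  sigmaComplete : ∀ E : ℕ → carrier, ∃ s, IsLUB (range E) s
  μ : carrier → ℝ
  μ_nonneg : ∀ a, 0 ≤ μ a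
  μ_bot : μ ⊥ = 0
  μ_top : μ ⊤ = 1
  μ_isLUB : ∀ (E : ℕ → carrier) (s : carrier), Pairwise (fun m n => E m ⊓ E n = ⊥) →
    IsLUB (range E) s → HasSum (fun n => μ (E n)) (μ s)
  μ_pos : ∀ a, a ≠ ⊥ → 0 < μ a

namespace ProbAlg

instance : CoeSort ProbAlg.{u} (Type u) := ⟨ProbAlg.carrier⟩

instance (X : ProbAlg.{u}) : BooleanAlgebra X := X.boolAlg

/-- A morphism `X ⟶ Y` of probability algebras is a measure-preserving homomorphism of
sigma-complete Boolean algebras in the opposite direction, from `Y` to `X`. -/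
@[ext]
structure Hom (X Y : ProbAlg.{u}) where
  pull : SigmaHom Y X
  measure_pull : ∀ a, X.μ (pull a) = Y.μ a

instance : Category ProbAlg.{u} where
  Hom := Hom
  id X := ⟨SigmaHom.id X, fun _ => rfl⟩
  comp f g := ⟨f.pull.comp g.pull, fun a =>
    (f.measure_pull (g.pull a)).trans (g.measure_pull a)⟩

end ProbAlg

/-! ### Two-valued homomorphisms that preserve prescribed countable joins -/

/-- The filter of "generic" two-valued homomorphisms: a property holds generically if it holds
for all two-valued homomorphisms that preserve all joins from some countable list. -/
def genericFilter (A : Type*) [BooleanAlgebra A] : Filter (BoundedLatticeHom A Prop) where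
  sets := {S | ∃ F : Set (ℕ → A), F.Countable ∧ ∀ w : BoundedLatticeHom A Prop,
    (∀ E ∈ F, ∀ s, IsLUB (range E) s → w s → ∃ n, w (E n)) → w ∈ S}
  univ_sets := ⟨∅, countable_empty, fun _ _ => trivial⟩
  sets_of_superset := by
    rintro S T ⟨F, hF, h⟩ hST
    exact ⟨F, hF, fun w hw => hST (h w hw)⟩
  inter_sets := by
    rintro S T ⟨F, hF, h⟩ ⟨G, hG, k⟩
    exact ⟨F ∪ G, hF.union hG, fun w hw =>
      ⟨h w fun E hE => hw E (Or.inl hE), k w fun E hE => hw E (Or.inr hE)⟩⟩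

section Generic

variable {A B : Type*} [BooleanAlgebra A] [BooleanAlgebra B]

theorem mem_genericFilter {S : Set (BoundedLatticeHom A Prop)} :
    S ∈ genericFilter A ↔ ∃ F : Set (ℕ → A), F.Countable ∧ ∀ w : BoundedLatticeHom A Prop,
      (∀ E ∈ F, ∀ s, IsLUB (range E) s → w s → ∃ n, w (E n)) → w ∈ S := Iff.rfl

instance : CountableInterFilter (genericFilter A) where
  countable_sInter_mem S hS h := by
    choose! F hF hw using h
    refine ⟨⋃ s ∈ S, F s, hS.biUnion hF, fun w h => ?_⟩
    exact fun s hs => hw s hs w fun E hE => h E (mem_biUnion hs hE)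

theorem eventually_isLUB {E : ℕ → A} {s : A} (h : IsLUB (range E) s) :
    ∀ᶠ w in genericFilter A, (w s ↔ ∃ n, w (E n)) := by
  refine ⟨{E}, countable_singleton E, fun w hw => ⟨hw E rfl s h, ?_⟩⟩
  rintro ⟨n, hn⟩
  exact OrderHomClass.mono w (h.1 ⟨n, rfl⟩) hn

theorem exists_ultra {a : ℕ → A} (ha : Antitone a) (h0 : ∀ n, a n ≠ ⊥) :
    ∃ w : BoundedLatticeHom A Prop, ∀ n, w (a n) := by
  let F : Order.PFilter A := Order.IsPFilter.toPFilter (F := {b | ∃ n, a n ≤ b})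
    (Order.IsPFilter.of_def ⟨a 0, 0, le_rfl⟩
      (by
        rintro x ⟨m, hm⟩ y ⟨n, hn⟩
        exact ⟨a (max m n), ⟨_, le_rfl⟩, (ha (le_max_left m n)).trans hm,
          (ha (le_max_right m n)).trans hn⟩)
      (by
        rintro x y hxy ⟨n, hn⟩
        exact ⟨n, hn.trans hxy⟩))
  have hF : ∀ b, b ∈ F ↔ ∃ n, a n ≤ b := fun b => Iff.rfl
  have hd : Disjoint (F : Set A) ((Order.Ideal.principal (⊥ : A) : Order.Ideal A) : Set A) := by
    rw [Set.disjoint_left]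
    intro b hb hb'
    obtain ⟨n, hn⟩ := (hF b).1 hb
    have : b = ⊥ := le_bot_iff.1 hb'
    exact h0 n (le_bot_iff.1 (this ▸ hn))
  obtain ⟨J, hJ, -, hFJ⟩ := DistribLattice.prime_ideal_of_disjoint_filter_ideal hd
  have htop : (⊤ : A) ∉ J := fun h => Set.disjoint_left.1 hFJ ((hF ⊤).2 ⟨0, le_top⟩) h
  refine ⟨{ toFun := fun b => b ∉ J, map_sup' := ?_, map_inf' := ?_, map_top' := ?_,
            map_bot' := ?_ }, fun n => ?_⟩
  · intro x y
    simp only [Order.Ideal.sup_mem_iff, sup_Prop_eq, eq_iff_iff]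
    tauto
  · intro x y
    simp only [inf_Prop_eq, eq_iff_iff]
    constructor
    · intro h
      exact ⟨fun hx => h (J.lower inf_le_left hx), fun hy => h (J.lower inf_le_right hy)⟩
    · rintro ⟨hx, hy⟩ h
      exact (hJ.mem_or_mem h).elim hx hy
  · simpa using htop
  · simp
  · exact Set.disjoint_left.1 hFJ ((hF _).2 ⟨n, le_rfl⟩)

theorem frequently_generic {a : A} (ha : a ≠ ⊥) : ∃ᶠ w in genericFilter A, w a := by
  intro hcon
  obtain ⟨F, hF, hw⟩ := mem_genericFilter.1 hcon
  have step : ∀ (E : ℕ → A) (b : A), b ≠ ⊥ → ∃ c ≤ b, c ≠ ⊥ ∧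
      ∀ s, IsLUB (range E) s → (c ≤ sᶜ ∨ ∃ n, c ≤ E n) := by
    intro E b hb
    by_cases h : ∃ n, b ⊓ E n ≠ ⊥
    · obtain ⟨n, hn⟩ := h
      exact ⟨b ⊓ E n, inf_le_left, hn, fun s _ => Or.inr ⟨n, inf_le_right⟩⟩
    · push Not at h
      refine ⟨b, le_rfl, hb, fun s hs => Or.inl ?_⟩
      refine le_compl_comm.1 (hs.2 ?_)
      rintro _ ⟨n, rfl⟩
      have := h n
      exact (disjoint_iff.2 this).symm.le_compl_right
  choose! c hcle hc0 hc using step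
  obtain ⟨e, he⟩ : ∃ e : ℕ → (ℕ → A), F ⊆ range e := by
    rcases F.eq_empty_or_nonempty with rfl | hne
    · exact ⟨fun _ _ => ⊥, empty_subset _⟩
    · obtain ⟨e, rfl⟩ := hF.exists_eq_range hne
      exact ⟨e, le_rfl⟩
  let x : ℕ → A := fun n => Nat.rec a (fun k b => c (e k) b) n
  have hxs : ∀ n, x (n + 1) = c (e n) (x n) := fun n => rfl
  have hx0 : ∀ n, x n ≠ ⊥ := by
    intro n
    induction n with
    | zero => exact ha
    | succ n ih => rw [hxs]; exact hc0 _ _ ih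
  have hanti : Antitone x := antitone_nat_of_succ_le fun n => by
    rw [hxs]; exact hcle _ _ (hx0 n)
  obtain ⟨w, hwx⟩ := exists_ultra hanti hx0
  refine hw w ?_ (hwx 0)
  intro E hE s hs hws
  obtain ⟨k, rfl⟩ := he hE
  rcases hc (e k) (x k) (hx0 k) s hs with h | ⟨n, hn⟩
  · exfalso
    have h1 : w (s ⊓ sᶜ) := by
      rw [map_inf]
      exact ⟨hws, OrderHomClass.mono w h (hwx (k + 1))⟩
    rw [inf_compl_self, map_bot] at h1
    exact h1
  · exact ⟨n, OrderHomClass.mono w hn (hwx (k + 1))⟩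

theorem ultra_compl (w : BoundedLatticeHom A Prop) (a : A) : w aᶜ ↔ ¬ w a := by
  rw [map_compl']
  exact Iff.rfl

theorem eq_of_generic {a b : A} (h : ∀ᶠ w in genericFilter A, (w a ↔ w b)) : a = b := by
  have key : ∀ {a b : A}, (∀ᶠ w in genericFilter A, (w a ↔ w b)) → a ≤ b := by
    intro a b h
    by_contra hab
    have hne : a ⊓ bᶜ ≠ ⊥ := by
      exact fun h => hab (by rwa [← disjoint_iff, disjoint_compl_right_iff] at h)
    obtain ⟨w, hw1, hw2⟩ := ((frequently_generic hne).and_eventually h).exists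
    rw [map_inf] at hw1
    exact (ultra_compl w b).1 hw1.2 (hw2.1 hw1.1)
  exact le_antisymm (key h) (key (h.mono fun w hw => hw.symm))

/-- Restricting a two-valued homomorphism along a homomorphism. -/
noncomputable def ultraComap (f : SigmaHom A B) (w : BoundedLatticeHom B Prop) : BoundedLatticeHom A Prop :=
  w.comp f.toBoundedLatticeHom

@[simp] theorem ultraComap_apply (f : SigmaHom A B) (w : BoundedLatticeHom B Prop) (a : A) :
    ultraComap f w a = w (f a) := rfl

theorem tendsto_ultraComap (f : SigmaHom A B) :
    Filter.Tendsto (ultraComap f) (genericFilter B) (genericFilter A) := by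
  rintro S ⟨F, hF, h⟩
  refine ⟨(fun E n => f (E n)) '' F, hF.image _, fun w hw => h _ fun E hE s hs hws => ?_⟩
  exact hw _ ⟨E, hE, rfl⟩ (f s) (f.map_isLUB hs) hws

/-- If a generically defined `α`-valued function pulls back a generating family of sets to
elements of `A`, then it pulls back all measurable sets to elements of `A`. -/
theorem exists_hom_of_generic (hA : ∀ E : ℕ → A, ∃ s, IsLUB (range E) s)
    {α : Type*} [m : MeasurableSpace α] (C : Set (Set α)) (hC : m = MeasurableSpace.generateFrom C)
    (v : BoundedLatticeHom A Prop → α)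
    (h : ∀ s ∈ C, ∃ a : A, ∀ᶠ w in genericFilter A, (v w ∈ s ↔ w a)) :
    ∃ J : SigmaHom (MeasSet α) A, ∀ D : MeasSet α,
      ∀ᶠ w in genericFilter A, (v w ∈ (D : Set α) ↔ w (J D)) := by
  have key : ∀ D : MeasSet α, ∃ a : A,
      ∀ᶠ w in genericFilter A, (v w ∈ (D : Set α) ↔ w a) := by
    rintro ⟨D, hD⟩
    subst hC
    induction D, hD using MeasurableSpace.generateFrom_induction with
    | hC t ht _ => exact h t ht
    | empty => exact ⟨⊥, Filter.Eventually.of_forall fun w => by simp⟩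
    | compl t _ ih =>
      obtain ⟨a, ha⟩ := ih
      refine ⟨aᶜ, ha.mono fun w hw => ?_⟩
      rw [ultra_compl, ← hw]
      rfl
    | iUnion t _ ih =>
      choose a ha using ih
      obtain ⟨s, hs⟩ := hA a
      refine ⟨s, ?_⟩
      filter_upwards [eventually_countable_forall.2 ha, eventually_isLUB hs] with w h1 h2
      rw [h2]
      simp only [mem_iUnion]
      exact exists_congr h1
  choose J hJ using key
  refine ⟨{ toFun := J, map_sup' := ?_, map_inf' := ?_, map_top' := ?_, map_bot' := ?_,
            map_isLUB' := ?_ }, hJ⟩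
  · intro D E
    refine eq_of_generic ?_
    filter_upwards [hJ D, hJ E, hJ (D ⊔ E)] with w h1 h2 h3
    rw [← h3, map_sup]
    change _ ↔ (w (J D) ∨ w (J E))
    rw [← h1, ← h2]
    rfl
  · intro D E
    refine eq_of_generic ?_
    filter_upwards [hJ D, hJ E, hJ (D ⊓ E)] with w h1 h2 h3
    rw [← h3, map_inf]
    change _ ↔ (w (J D) ∧ w (J E))
    rw [← h1, ← h2]
    rfl
  · refine eq_of_generic ?_
    filter_upwards [hJ ⊤] with w h1
    rw [← h1, map_top]
    exact Iff.rfl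
  · refine eq_of_generic ?_
    filter_upwards [hJ ⊥] with w h1
    rw [← h1, map_bot]
    exact Iff.rfl
  · intro E s hs
    obtain ⟨t, ht⟩ := hA fun n => J (E n)
    have : J s = t := by
      refine eq_of_generic ?_
      filter_upwards [hJ s, eventually_countable_forall.2 fun n => hJ (E n),
        eventually_isLUB ht] with w h1 h2 h3
      rw [h3, ← h1, MeasSet.isLUB_iff.1 hs]
      simp only [mem_iUnion]
      exact exists_congr h2
    rw [this]
    exact ht

open Classical in
/-- The value at a two-valued homomorphism of an abstract complex-valued measurable function
(zero if there is no such value). -/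
noncomputable def valueAt (f : SigmaHom BorelC A) (w : BoundedLatticeHom A Prop) : ℂ :=
  if h : ∃ z : ℂ, ∀ U : BorelC, IsOpen (U : Set ℂ) → z ∈ (U : Set ℂ) → w (f U) then h.choose
  else 0

/-- Open balls, as abstract measurable sets. -/
def ballC (z : ℂ) (r : ℝ) : BorelC := ⟨Metric.ball z r, Metric.isOpen_ball.measurableSet⟩

/-- Closed balls, as abstract measurable sets. -/
def closedBallC (z : ℂ) (r : ℝ) : BorelC :=
  ⟨Metric.closedBall z r, Metric.isClosed_closedBall.measurableSet⟩

theorem valueAt_exists (f : SigmaHom BorelC A) : ∀ᶠ w in genericFilter A,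
    ∃ z : ℂ, ∀ U : BorelC, IsOpen (U : Set ℂ) → z ∈ (U : Set ℂ) → w (f U) := by
  have hcov : ∀ n : ℕ, IsLUB (range fun k =>
      f (ballC (TopologicalSpace.denseSeq ℂ k) (1 / ((n : ℝ) + 1)))) (f ⊤) := by
    intro n
    refine f.map_isLUB (MeasSet.isLUB_iff.2 ?_)
    symm
    refine eq_univ_of_forall fun z => ?_
    have hr : (0 : ℝ) < 1 / ((n : ℝ) + 1) := by positivity
    obtain ⟨k, hk⟩ := (TopologicalSpace.denseRange_denseSeq ℂ).exists_mem_open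
      Metric.isOpen_ball ⟨z, Metric.mem_ball_self hr⟩
    exact mem_iUnion.2 ⟨k, Metric.mem_ball_comm.1 hk⟩
  filter_upwards [eventually_countable_forall.2 fun n => eventually_isLUB (hcov n)] with w hw
  have hk : ∀ n : ℕ, ∃ k, w (f (ballC (TopologicalSpace.denseSeq ℂ k) (1 / ((n : ℝ) + 1)))) :=
    fun n => (hw n).1 (by rw [map_top, map_top]; trivial)
  choose k hk using hk
  set x : ℕ → ℂ := fun n => TopologicalSpace.denseSeq ℂ (k n) with hx
  have hxy : ∀ m n, dist (x m) (x n) ≤ 1 / ((m : ℝ) + 1) + 1 / ((n : ℝ) + 1) := by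
    intro m n
    by_contra hcon
    have hemp : ballC (x m) (1 / ((m : ℝ) + 1)) ⊓ ballC (x n) (1 / ((n : ℝ) + 1)) = ⊥ :=
      Subtype.ext (disjoint_iff_inter_eq_empty.1 (Metric.ball_disjoint_ball (not_le.1 hcon).le))
    have h1 : w (f (ballC (x m) (1 / ((m : ℝ) + 1)) ⊓ ballC (x n) (1 / ((n : ℝ) + 1)))) := by
      rw [map_inf, map_inf]
      exact ⟨hk m, hk n⟩
    rw [hemp, map_bot, map_bot] at h1
    exact h1
  have hlim : Filter.Tendsto (fun n : ℕ => 1 / ((n : ℝ) + 1)) Filter.atTop (nhds 0) :=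
    tendsto_one_div_add_atTop_nhds_zero_nat
  have hcau : CauchySeq x := by
    refine cauchySeq_of_le_tendsto_0 (fun N : ℕ => 1 / ((N : ℝ) + 1) + 1 / ((N : ℝ) + 1)) ?_
      (by simpa using hlim.add hlim)
    intro n m N hn hm
    refine (hxy n m).trans (add_le_add ?_ ?_)
    · exact one_div_le_one_div_of_le (by positivity) (by exact_mod_cast Nat.succ_le_succ hn)
    · exact one_div_le_one_div_of_le (by positivity) (by exact_mod_cast Nat.succ_le_succ hm)
  obtain ⟨z, hz⟩ := cauchySeq_tendsto_of_complete hcau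
  refine ⟨z, fun U hU hzU => ?_⟩
  obtain ⟨ε, hε, hεU⟩ := Metric.isOpen_iff.1 hU z hzU
  obtain ⟨n, h1, h2⟩ := ((Metric.tendsto_nhds.1 hz (ε / 2) (half_pos hε)).and
    (hlim.eventually (gt_mem_nhds (half_pos hε)))).exists
  have hle : ballC (x n) (1 / ((n : ℝ) + 1)) ≤ U := by
    refine Subset.trans (Metric.ball_subset_ball' ?_) hεU
    linarith
  exact OrderHomClass.mono w (OrderHomClass.mono f hle) (hk n)

theorem valueAt_open (f : SigmaHom BorelC A) : ∀ᶠ w in genericFilter A,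
    ∀ U : BorelC, IsOpen (U : Set ℂ) → valueAt f w ∈ (U : Set ℂ) → w (f U) := by
  filter_upwards [valueAt_exists f] with w hw
  rw [valueAt, dif_pos hw]
  exact hw.choose_spec

/-- Generically, `f` takes its value in `E` if and only if `f E` is true. -/
theorem valueAt_mem_iff (f : SigmaHom BorelC A) (E : BorelC) :
    ∀ᶠ w in genericFilter A, (valueAt f w ∈ (E : Set ℂ) ↔ w (f E)) := by
  obtain ⟨E, hE⟩ := E
  induction E, hE using MeasurableSet.induction_on_open with
  | isOpen U hU =>
    let V : ℕ → BorelC := fun n => ⟨(Metric.thickening (1 / ((n : ℝ) + 1)) Uᶜ)ᶜ,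
      Metric.isOpen_thickening.measurableSet.compl⟩
    have hV : IsLUB (range V) ⟨U, hU.measurableSet⟩ := by
      refine MeasSet.isLUB_iff.2 (Subset.antisymm ?_ ?_)
      · intro z hz
        obtain ⟨ε, hε, hεU⟩ := Metric.isOpen_iff.1 hU z hz
        obtain ⟨n, hn⟩ := exists_nat_one_div_lt hε
        refine mem_iUnion.2 ⟨n, fun hzn => ?_⟩
        obtain ⟨y, hy, hzy⟩ := Metric.mem_thickening_iff.1 hzn
        exact hy (hεU (Metric.mem_ball'.2 (hzy.trans hn)))
      · refine iUnion_subset fun n => compl_subset_comm.1 ?_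
        exact Metric.self_subset_thickening (by positivity) _
    filter_upwards [valueAt_open f, eventually_isLUB (f.map_isLUB hV)] with w h1 h2
    refine ⟨h1 ⟨U, hU.measurableSet⟩ hU, fun hw => ?_⟩
    obtain ⟨n, hn⟩ := h2.1 hw
    by_contra hz
    have h3 := h1 (V n)ᶜ (by
      change IsOpen ((Metric.thickening (1 / ((n : ℝ) + 1)) Uᶜ)ᶜ)ᶜ
      rw [compl_compl]
      exact Metric.isOpen_thickening) (by
      change _ ∈ ((Metric.thickening (1 / ((n : ℝ) + 1)) Uᶜ)ᶜ)ᶜ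
      rw [compl_compl]
      exact Metric.self_subset_thickening (by positivity) _ hz)
    rw [map_compl', ultra_compl] at h3
    exact h3 hn
  | compl t ht ih =>
    filter_upwards [ih] with w hw
    have : (⟨tᶜ, ht.compl⟩ : BorelC) = (⟨t, ht⟩ : BorelC)ᶜ := rfl
    rw [this, map_compl', ultra_compl, ← hw]
    rfl
  | iUnion t _ ht ih =>
    have hL := f.map_isLUB (MeasSet.isLUB_iUnion t ht (MeasurableSet.iUnion ht))
    filter_upwards [eventually_countable_forall.2 ih, eventually_isLUB hL] with w h1 h2
    rw [h2]
    simp only [mem_iUnion]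
    exact exists_congr h1

theorem valueAt_eq {f : SigmaHom BorelC A} {v : BoundedLatticeHom A Prop → ℂ}
    (h : ∀ E : BorelC, ∀ᶠ w in genericFilter A, (v w ∈ (E : Set ℂ) ↔ w (f E))) :
    ∀ᶠ w in genericFilter A, valueAt f w = v w := by
  have h1 : ∀ p : ℕ × ℕ, ∀ᶠ w in genericFilter A,
      (v w ∈ Metric.ball (TopologicalSpace.denseSeq ℂ p.1) (1 / ((p.2 : ℝ) + 1)) ↔
        valueAt f w ∈ Metric.ball (TopologicalSpace.denseSeq ℂ p.1) (1 / ((p.2 : ℝ) + 1))) := by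
    intro p
    filter_upwards [h (ballC (TopologicalSpace.denseSeq ℂ p.1) (1 / ((p.2 : ℝ) + 1))),
      valueAt_mem_iff f (ballC (TopologicalSpace.denseSeq ℂ p.1) (1 / ((p.2 : ℝ) + 1)))]
      with w h1 h2
    exact h1.trans h2.symm
  filter_upwards [eventually_countable_forall.2 h1] with w hw
  refine eq_of_forall_dist_le fun ε hε => ?_
  obtain ⟨n, hn⟩ := exists_nat_one_div_lt (half_pos hε)
  have hr : (0 : ℝ) < 1 / ((n : ℝ) + 1) := by positivity
  obtain ⟨k, hk⟩ := (TopologicalSpace.denseRange_denseSeq ℂ).exists_mem_open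
    Metric.isOpen_ball ⟨v w, Metric.mem_ball_self hr⟩
  have h2 := Metric.mem_ball_comm.1 hk
  have h3 := (hw (k, n)).1 h2
  have := dist_triangle_right (valueAt f w) (v w) (TopologicalSpace.denseSeq ℂ k)
  rw [Metric.mem_ball] at h2 h3
  dsimp only at h2 h3
  linarith

theorem hom_eq_of_valueAt {f g : SigmaHom BorelC A}
    (h : ∀ᶠ w in genericFilter A, valueAt f w = valueAt g w) : f = g := by
  ext E
  refine eq_of_generic ?_
  filter_upwards [h, valueAt_mem_iff f E, valueAt_mem_iff g E] with w h1 h2 h3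
  rw [← h2, ← h3, h1]

/-- Two abstract complex-valued measurable functions have a unique joint abstract measurable
function with values in `ℂ × ℂ`. -/
theorem existsUnique_joint (hA : ∀ E : ℕ → A, ∃ s, IsLUB (range E) s)
    (f g : SigmaHom BorelC A) :
    ∃! J : SigmaHom (MeasSet (ℂ × ℂ)) A, ∀ E F : BorelC,
      J ⟨(E : Set ℂ) ×ˢ (F : Set ℂ), E.2.prod F.2⟩ = f E ⊓ g F := by
  obtain ⟨J, hJ⟩ := exists_hom_of_generic hA _ (generateFrom_prod (α := ℂ) (β := ℂ)).symm
    (fun w => (valueAt f w, valueAt g w)) (by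
      rintro _ ⟨E, hE, F, hF, rfl⟩
      refine ⟨f ⟨E, hE⟩ ⊓ g ⟨F, hF⟩, ?_⟩
      filter_upwards [valueAt_mem_iff f ⟨E, hE⟩, valueAt_mem_iff g ⟨F, hF⟩] with w h1 h2
      rw [map_inf]
      exact and_congr h1 h2)
  refine ⟨J, fun E F => eq_of_generic ?_, fun J' hJ' => ?_⟩
  · filter_upwards [hJ ⟨(E : Set ℂ) ×ˢ (F : Set ℂ), E.2.prod F.2⟩, valueAt_mem_iff f E,
      valueAt_mem_iff g F] with w h1 h2 h3
    rw [← h1, map_inf]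
    exact and_congr h2 h3
  · ext ⟨D, hD⟩
    have hD' : MeasurableSet[MeasurableSpace.generateFrom (image2 (fun s t => s ×ˢ t)
        {s : Set ℂ | MeasurableSet s} {t : Set ℂ | MeasurableSet t})] D := by
      rw [generateFrom_prod]; exact hD
    refine eq_of_generic ?_
    refine Filter.Eventually.congr (p := fun w => (w (J' ⟨D, hD⟩) ↔
      (valueAt f w, valueAt g w) ∈ D)) ?_ ((hJ ⟨D, hD⟩).mono fun w hw => by rw [← hw])
    induction D, hD' using MeasurableSpace.generateFrom_induction with
    | hC t ht _ =>
      obtain ⟨E, hE, F, hF, rfl⟩ := ht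
      filter_upwards [valueAt_mem_iff f ⟨E, hE⟩, valueAt_mem_iff g ⟨F, hF⟩] with w h1 h2
      rw [hJ' ⟨E, hE⟩ ⟨F, hF⟩, map_inf]
      exact (and_congr h1 h2).symm
    | empty =>
      refine Filter.Eventually.of_forall fun w => ?_
      have : (⟨∅, hD⟩ : MeasSet (ℂ × ℂ)) = ⊥ := rfl
      rw [this, map_bot, map_bot]
      exact Iff.rfl
    | compl t ht ih =>
      have ht' : MeasurableSet t := by rw [generateFrom_prod] at ht; exact ht
      filter_upwards [ih ht'] with w hw
      have : (⟨tᶜ, hD⟩ : MeasSet (ℂ × ℂ)) = (⟨t, ht'⟩ : MeasSet (ℂ × ℂ))ᶜ := rfl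
      rw [this, map_compl', ultra_compl, hw]
      rfl
    | iUnion t ht ih =>
      have ht' : ∀ n, MeasurableSet (t n) := fun n => by
        have := ht n; rw [generateFrom_prod] at this; exact this
      have hL := J'.map_isLUB (MeasSet.isLUB_iUnion t ht' hD)
      filter_upwards [eventually_countable_forall.2 fun n => ih n (ht' n),
        eventually_isLUB hL] with w h1 h2
      rw [h2]
      simp only [mem_iUnion]
      exact exists_congr h1

end Generic

/-! ### Bounded abstract measurable functions on a probability algebra -/

/-- `L^∞(X)`: the abstractly measurable maps from `X` to `ℂ` (homomorphisms from the Borel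
sigma-algebra of `ℂ` to `X` that preserve countable joins) which are bounded. -/
structure LInfty (X : ProbAlg.{u}) where
  hom : SigmaHom BorelC X
  bounded : ∃ M : ℝ, hom (closedBallC 0 M) = ⊤

namespace LInfty

variable {X Y Z : ProbAlg.{u}}

/-- The joint abstract measurable function `(f, g)` with values in `ℂ × ℂ`. -/
noncomputable def joint (f g : LInfty X) : SigmaHom (MeasSet (ℂ × ℂ)) X :=
  (existsUnique_joint X.sigmaComplete f.hom g.hom).choose

theorem joint_prod (f g : LInfty X) (E F : BorelC) :
    joint f g ⟨(E : Set ℂ) ×ˢ (F : Set ℂ), E.2.prod F.2⟩ = f.hom E ⊓ g.hom F :=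
  (existsUnique_joint X.sigmaComplete f.hom g.hom).choose_spec.1 E F

/-- The composition of an abstract measurable function with a continuous map. -/
noncomputable def map (φ : ℂ → ℂ) (hφ : Continuous φ) (f : LInfty X) : LInfty X where
  hom := f.hom.comp (MeasSet.preimage φ hφ.measurable)
  bounded := by
    obtain ⟨M, hM⟩ := f.bounded
    obtain ⟨R, hR⟩ := ((isCompact_closedBall (0 : ℂ) M).image hφ).isBounded.subset_closedBall 0
    refine ⟨R, top_le_iff.1 ?_⟩
    rw [← hM]
    exact OrderHomClass.mono f.hom (image_subset_iff.1 hR)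

/-- The conditional binary operation: the composition of the joint function `(f, g)` with a
continuous map `φ`. -/
noncomputable def map₂ (φ : ℂ × ℂ → ℂ) (hφ : Continuous φ) (f g : LInfty X) : LInfty X where
  hom := (joint f g).comp (MeasSet.preimage φ hφ.measurable)
  bounded := by
    obtain ⟨M, hM⟩ := f.bounded
    obtain ⟨N, hN⟩ := g.bounded
    obtain ⟨R, hR⟩ := (((isCompact_closedBall (0 : ℂ) M).prod
      (isCompact_closedBall (0 : ℂ) N)).image hφ).isBounded.subset_closedBall 0
    refine ⟨R, top_le_iff.1 ?_⟩
    have h := joint_prod f g (closedBallC 0 M) (closedBallC 0 N)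
    rw [hM, hN, inf_top_eq] at h
    rw [← h]
    exact OrderHomClass.mono (joint f g) (image_subset_iff.1 hR)

open Classical in
/-- The constant function with value `c`. -/
noncomputable def const (X : ProbAlg.{u}) (c : ℂ) : LInfty X where
  hom :=
    { toFun := fun E => if c ∈ (E : Set ℂ) then ⊤ else ⊥
      map_sup' := fun E F => by
        by_cases h1 : c ∈ (E : Set ℂ) <;> by_cases h2 : c ∈ (F : Set ℂ) <;> simp [h1, h2]
      map_inf' := fun E F => by
        by_cases h1 : c ∈ (E : Set ℂ) <;> by_cases h2 : c ∈ (F : Set ℂ) <;> simp [h1, h2]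
      map_top' := if_pos (mem_univ c)
      map_bot' := if_neg (notMem_empty c)
      map_isLUB' := fun E s hs => by
        rw [MeasSet.isLUB_iff] at hs
        by_cases h : c ∈ (s : Set ℂ)
        · rw [if_pos h]
          rw [hs] at h
          obtain ⟨n, hn⟩ := mem_iUnion.1 h
          exact ⟨fun _ _ => le_top, fun b hb => by simpa [hn] using hb ⟨n, rfl⟩⟩
        · rw [if_neg h]
          refine ⟨?_, fun _ _ => bot_le⟩
          rintro _ ⟨n, rfl⟩
          have hn : c ∉ (E n : Set ℂ) := fun hn => h (hs ▸ mem_iUnion.2 ⟨n, hn⟩)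
          simp [hn] }
  bounded := ⟨‖c‖, if_pos (by simp [closedBallC])⟩

noncomputable instance : Zero (LInfty X) := ⟨const X 0⟩
noncomputable instance : One (LInfty X) := ⟨const X 1⟩
noncomputable instance : Add (LInfty X) := ⟨map₂ (fun p => p.1 + p.2) (by fun_prop)⟩
noncomputable instance : Mul (LInfty X) := ⟨map₂ (fun p => p.1 * p.2) (by fun_prop)⟩
noncomputable instance : Neg (LInfty X) := ⟨map (fun z => -z) (by fun_prop)⟩
noncomputable instance : Star (LInfty X) := ⟨map (fun z => star z) continuous_star⟩
noncomputable instance : SMul ℂ (LInfty X) := ⟨fun c f => map (fun z => c * z) (by fun_prop) f⟩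

/-- The value of an abstract function at a two-valued homomorphism. -/
noncomputable abbrev val (f : LInfty X) (w : BoundedLatticeHom X Prop) : ℂ := valueAt f.hom w

theorem ext_hom {f g : LInfty X} (h : f.hom = g.hom) : f = g := by
  cases f; cases g; subst h; rfl

theorem ext_val {f g : LInfty X} (h : ∀ᶠ w in genericFilter X, f.val w = g.val w) : f = g :=
  ext_hom (hom_eq_of_valueAt h)

theorem val_mem_iff (f : LInfty X) (E : BorelC) :
    ∀ᶠ w in genericFilter X, (f.val w ∈ (E : Set ℂ) ↔ w (f.hom E)) :=
  valueAt_mem_iff f.hom E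

theorem val_joint (f g : LInfty X) (D : MeasSet (ℂ × ℂ)) :
    ∀ᶠ w in genericFilter X, ((f.val w, g.val w) ∈ (D : Set (ℂ × ℂ)) ↔ w (joint f g D)) := by
  obtain ⟨J, hJ⟩ := exists_hom_of_generic X.sigmaComplete _
    (generateFrom_prod (α := ℂ) (β := ℂ)).symm (fun w => (f.val w, g.val w)) (by
      rintro _ ⟨E, hE, F, hF, rfl⟩
      refine ⟨f.hom ⟨E, hE⟩ ⊓ g.hom ⟨F, hF⟩, ?_⟩
      filter_upwards [val_mem_iff f ⟨E, hE⟩, val_mem_iff g ⟨F, hF⟩] with w h1 h2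
      rw [map_inf]
      exact and_congr h1 h2)
  have hJ' : J = joint f g := by
    refine (existsUnique_joint X.sigmaComplete f.hom g.hom).choose_spec.2 J fun E F =>
      eq_of_generic ?_
    filter_upwards [hJ ⟨(E : Set ℂ) ×ˢ (F : Set ℂ), E.2.prod F.2⟩, val_mem_iff f E,
      val_mem_iff g F] with w h1 h2 h3
    rw [← h1, map_inf]
    exact and_congr h2 h3
  rw [← hJ']
  exact hJ D

theorem val_map (φ : ℂ → ℂ) (hφ : Continuous φ) (f : LInfty X) :
    ∀ᶠ w in genericFilter X, (map φ hφ f).val w = φ (f.val w) :=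
  valueAt_eq fun E => val_mem_iff f (MeasSet.preimage φ hφ.measurable E)

theorem val_map₂ (φ : ℂ × ℂ → ℂ) (hφ : Continuous φ) (f g : LInfty X) :
    ∀ᶠ w in genericFilter X, (map₂ φ hφ f g).val w = φ (f.val w, g.val w) :=
  valueAt_eq fun E => val_joint f g (MeasSet.preimage φ hφ.measurable E)

theorem val_const (c : ℂ) : ∀ᶠ w in genericFilter X, (const X c).val w = c := by
  refine valueAt_eq (v := fun _ => c) fun E => Filter.Eventually.of_forall fun w => ?_
  by_cases h : c ∈ (E : Set ℂ)
  · have : (const X c).hom E = ⊤ := if_pos h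
    rw [this, map_top]
    exact iff_of_true h trivial
  · have : (const X c).hom E = ⊥ := if_neg h
    rw [this, map_bot]
    exact iff_of_false h id

theorem val_zero : ∀ᶠ w in genericFilter X, (0 : LInfty X).val w = 0 := val_const 0
theorem val_one : ∀ᶠ w in genericFilter X, (1 : LInfty X).val w = 1 := val_const 1
theorem val_add (f g : LInfty X) :
    ∀ᶠ w in genericFilter X, (f + g).val w = f.val w + g.val w := val_map₂ _ _ f g
theorem val_mul (f g : LInfty X) :
    ∀ᶠ w in genericFilter X, (f * g).val w = f.val w * g.val w := val_map₂ _ _ f g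
theorem val_neg (f : LInfty X) :
    ∀ᶠ w in genericFilter X, (-f).val w = -f.val w := val_map _ _ f
theorem val_star (f : LInfty X) :
    ∀ᶠ w in genericFilter X, (star f).val w = star (f.val w) := val_map _ _ f
theorem val_smul (c : ℂ) (f : LInfty X) :
    ∀ᶠ w in genericFilter X, (c • f).val w = c * f.val w := val_map _ _ f

noncomputable instance : CommRing (LInfty X) where
  add_assoc f g h := ext_val (by
    filter_upwards [val_add (f + g) h, val_add f g, val_add f (g + h), val_add g h]
      with w h1 h2 h3 h4
    rw [h1, h2, h3, h4]; ring)
  zero_add f := ext_val (by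
    filter_upwards [val_add 0 f, val_zero (X := X)] with w h1 h2
    rw [h1, h2]; ring)
  add_zero f := ext_val (by
    filter_upwards [val_add f 0, val_zero (X := X)] with w h1 h2
    rw [h1, h2]; ring)
  add_comm f g := ext_val (by
    filter_upwards [val_add f g, val_add g f] with w h1 h2
    rw [h1, h2]; ring)
  left_distrib f g h := ext_val (by
    filter_upwards [val_mul f (g + h), val_add g h, val_add (f * g) (f * h), val_mul f g,
      val_mul f h] with w h1 h2 h3 h4 h5
    rw [h1, h2, h3, h4, h5]; ring)
  right_distrib f g h := ext_val (by
    filter_upwards [val_mul (f + g) h, val_add f g, val_add (f * h) (g * h), val_mul f h,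
      val_mul g h] with w h1 h2 h3 h4 h5
    rw [h1, h2, h3, h4, h5]; ring)
  zero_mul f := ext_val (by
    filter_upwards [val_mul 0 f, val_zero (X := X)] with w h1 h2
    rw [h1, h2]; ring)
  mul_zero f := ext_val (by
    filter_upwards [val_mul f 0, val_zero (X := X)] with w h1 h2
    rw [h1, h2]; ring)
  mul_assoc f g h := ext_val (by
    filter_upwards [val_mul (f * g) h, val_mul f g, val_mul f (g * h), val_mul g h]
      with w h1 h2 h3 h4
    rw [h1, h2, h3, h4]; ring)
  one_mul f := ext_val (by
    filter_upwards [val_mul 1 f, val_one (X := X)] with w h1 h2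
    rw [h1, h2]; ring)
  mul_one f := ext_val (by
    filter_upwards [val_mul f 1, val_one (X := X)] with w h1 h2
    rw [h1, h2]; ring)
  mul_comm f g := ext_val (by
    filter_upwards [val_mul f g, val_mul g f] with w h1 h2
    rw [h1, h2]; ring)
  neg_add_cancel f := ext_val (by
    filter_upwards [val_add (-f) f, val_neg f, val_zero (X := X)] with w h1 h2 h3
    rw [h1, h2, h3]; ring)
  nsmul := nsmulRec
  zsmul := zsmulRec

noncomputable instance : Module ℂ (LInfty X) where
  one_smul f := ext_val (by
    filter_upwards [val_smul 1 f] with w h1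
    rw [h1]; ring)
  mul_smul c d f := ext_val (by
    filter_upwards [val_smul (c * d) f, val_smul c (d • f), val_smul d f] with w h1 h2 h3
    rw [h1, h2, h3]; ring)
  smul_zero c := ext_val (by
    filter_upwards [val_smul c 0, val_zero (X := X)] with w h1 h2
    rw [h1, h2]; ring)
  smul_add c f g := ext_val (by
    filter_upwards [val_smul c (f + g), val_add f g, val_add (c • f) (c • g), val_smul c f,
      val_smul c g] with w h1 h2 h3 h4 h5
    rw [h1, h2, h3, h4, h5]; ring)
  add_smul c d f := ext_val (by
    filter_upwards [val_smul (c + d) f, val_add (c • f) (d • f), val_smul c f, val_smul d f]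
      with w h1 h2 h3 h4
    rw [h1, h2, h3, h4]; ring)
  zero_smul f := ext_val (by
    filter_upwards [val_smul 0 f, val_zero (X := X)] with w h1 h2
    rw [h1, h2]; ring)

noncomputable instance : Algebra ℂ (LInfty X) := Algebra.ofModule
  (fun c f g => ext_val (by
    filter_upwards [val_mul (c • f) g, val_smul c f, val_smul c (f * g), val_mul f g]
      with w h1 h2 h3 h4
    rw [h1, h2, h3, h4]; ring))
  (fun c f g => ext_val (by
    filter_upwards [val_mul f (c • g), val_smul c g, val_smul c (f * g), val_mul f g]
      with w h1 h2 h3 h4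
    rw [h1, h2, h3, h4]; ring))

noncomputable instance : StarRing (LInfty X) where
  star_involutive f := ext_val (by
    filter_upwards [val_star (star f), val_star f] with w h1 h2
    rw [h1, h2, star_star])
  star_mul f g := ext_val (by
    filter_upwards [val_star (f * g), val_mul f g, val_mul (star g) (star f), val_star f,
      val_star g] with w h1 h2 h3 h4 h5
    rw [h1, h2, h3, h4, h5, star_mul])
  star_add f g := ext_val (by
    filter_upwards [val_star (f + g), val_add f g, val_add (star f) (star g), val_star f,
      val_star g] with w h1 h2 h3 h4 h5
    rw [h1, h2, h3, h4, h5, star_add])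

/-- The composition `f ∘ π` of an abstract measurable function with a morphism. -/
noncomputable def compHom (π : X ⟶ Y) (f : LInfty Y) : LInfty X where
  hom := (ProbAlg.Hom.pull π).comp f.hom
  bounded := by
    obtain ⟨M, hM⟩ := f.bounded
    exact ⟨M, by rw [SigmaHom.comp_apply, hM, map_top]⟩

theorem val_compHom (π : X ⟶ Y) (f : LInfty Y) (w : BoundedLatticeHom X Prop) :
    (compHom π f).val w = f.val (ultraComap (ProbAlg.Hom.pull π) w) := rfl

/-- The Koopman operator `L^∞(π) : L^∞(Y) → L^∞(X)`, `f ↦ f ∘ π`, of a morphism `π : X ⟶ Y`. -/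
noncomputable def koopman (π : X ⟶ Y) : LInfty Y →⋆ₐ[ℂ] LInfty X where
  toFun := compHom π
  map_one' := ext_val (by
    filter_upwards [(tendsto_ultraComap (ProbAlg.Hom.pull π)).eventually (val_one (X := Y)),
      val_one (X := X)] with w h1 h2
    rw [val_compHom, h1, h2])
  map_mul' f g := ext_val (by
    filter_upwards [(tendsto_ultraComap (ProbAlg.Hom.pull π)).eventually (val_mul f g),
      val_mul (compHom π f) (compHom π g)] with w h1 h2
    rw [val_compHom, h1, h2]; rfl)
  map_zero' := ext_val (by
    filter_upwards [(tendsto_ultraComap (ProbAlg.Hom.pull π)).eventually (val_zero (X := Y)),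
      val_zero (X := X)] with w h1 h2
    rw [val_compHom, h1, h2])
  map_add' f g := ext_val (by
    filter_upwards [(tendsto_ultraComap (ProbAlg.Hom.pull π)).eventually (val_add f g),
      val_add (compHom π f) (compHom π g)] with w h1 h2
    rw [val_compHom, h1, h2]; rfl)
  commutes' c := ext_val (by
    rw [Algebra.algebraMap_eq_smul_one, Algebra.algebraMap_eq_smul_one]
    filter_upwards [(tendsto_ultraComap (ProbAlg.Hom.pull π)).eventually
      (val_smul c (1 : LInfty Y)), (tendsto_ultraComap (ProbAlg.Hom.pull π)).eventually
      (val_one (X := Y)), val_one (X := X), val_smul c (1 : LInfty X)] with w h1 h2 h3 h4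
    rw [val_compHom, h1, h2, h4, h3])
  map_star' f := ext_val (by
    filter_upwards [(tendsto_ultraComap (ProbAlg.Hom.pull π)).eventually (val_star f),
      val_star (compHom π f)] with w h1 h2
    rw [val_compHom, h1, h2]; rfl)

/-- The image measure on `α` of an `α`-valued abstract measurable function `J` on `X`: the measure
which assigns to `D` the measure of the element `J⁻¹(D)` of `X`. -/
noncomputable def lawOf {α : Type*} [MeasurableSpace α] (J : SigmaHom (MeasSet α) X) : Measure α :=
  Measure.ofMeasurable (fun D hD => ENNReal.ofReal (X.μ (J ⟨D, hD⟩)))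
    (by
      have : J ⟨∅, MeasurableSet.empty⟩ = ⊥ := map_bot J
      rw [this, X.μ_bot, ENNReal.ofReal_zero])
    (by
      intro D hD hd
      have h := X.μ_isLUB _ _ (fun m n hmn => (by
          change J ⟨D m, hD m⟩ ⊓ J ⟨D n, hD n⟩ = ⊥
          have : (⟨D m, hD m⟩ : MeasSet α) ⊓ ⟨D n, hD n⟩ = ⊥ :=
            Subtype.ext (disjoint_iff_inter_eq_empty.1 (hd hmn))
          rw [← map_inf, this, map_bot]))
        (J.map_isLUB (MeasSet.isLUB_iUnion D hD (MeasurableSet.iUnion hD)))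
      rw [← h.tsum_eq, ENNReal.ofReal_tsum_of_nonneg (fun n => X.μ_nonneg _) h.summable])

/-- The law of `f`, a Borel probability measure on `ℂ`. -/
noncomputable def law (f : LInfty X) : Measure ℂ := lawOf f.hom

/-- The integral `∫_X f` of a bounded abstract measurable function. -/
noncomputable def integral (f : LInfty X) : ℂ := ∫ z, z ∂f.law

/-- `e` is the conditional expectation `E(f | Y)` of `f` along `π : X ⟶ Y`: the element of
`L^∞(Y)` whose integrals against all elements of `L^∞(Y)` agree with those of `f`. It is unique,
see `IsCondExp.unique`. -/
def IsCondExp (π : X ⟶ Y) (f : LInfty X) (e : LInfty Y) : Prop :=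
  ∀ g : LInfty Y, integral (f * koopman π g) = integral (e * g)

theorem lawOf_apply {α : Type*} [MeasurableSpace α] (J : SigmaHom (MeasSet α) X) (D : MeasSet α) :
    lawOf J (D : Set α) = ENNReal.ofReal (X.μ (J D)) :=
  Measure.ofMeasurable_apply _ D.2

instance {α : Type*} [MeasurableSpace α] (J : SigmaHom (MeasSet α) X) :
    IsProbabilityMeasure (lawOf J) where
  measure_univ := by
    have h := lawOf_apply J ⊤
    rw [map_top, X.μ_top, ENNReal.ofReal_one] at h
    exact h

theorem lawOf_comp_preimage {α β : Type*} [MeasurableSpace α] [MeasurableSpace β]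
    (J : SigmaHom (MeasSet α) X) (φ : α → β) (hφ : Measurable φ) :
    lawOf (J.comp (MeasSet.preimage φ hφ)) = (lawOf J).map φ := by
  ext D hD
  rw [Measure.map_apply hφ hD]
  exact (lawOf_apply _ ⟨D, hD⟩).trans (lawOf_apply J ⟨φ ⁻¹' D, hφ hD⟩).symm

theorem integrable_law (f : LInfty X) : Integrable (fun z => z) f.law := by
  obtain ⟨M, hM⟩ := f.bounded
  have h1 : f.law (Metric.closedBall 0 M) = 1 := by
    have h := lawOf_apply f.hom (closedBallC 0 M)
    rw [hM, X.μ_top, ENNReal.ofReal_one] at h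
    exact h
  have : IsProbabilityMeasure f.law := inferInstanceAs (IsProbabilityMeasure (lawOf f.hom))
  refine Integrable.of_bound (C := M) measurable_id.aestronglyMeasurable ?_
  have h2 : ∀ᵐ z ∂f.law, z ∈ Metric.closedBall (0 : ℂ) M :=
    (mem_ae_iff_prob_eq_one Metric.isClosed_closedBall.measurableSet).2 h1
  filter_upwards [h2] with z hz
  simpa using hz

theorem hom_eq_joint_fst (f g : LInfty X) :
    f.hom = (joint f g).comp (MeasSet.preimage Prod.fst measurable_fst) := by
  ext E
  have h := joint_prod f g E ⊤
  rw [map_top, inf_top_eq] at h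
  rw [← h]
  refine congrArg (joint f g) (Subtype.ext ?_)
  exact prod_univ

theorem hom_eq_joint_snd (f g : LInfty X) :
    g.hom = (joint f g).comp (MeasSet.preimage Prod.snd measurable_snd) := by
  ext E
  have h := joint_prod f g ⊤ E
  rw [map_top, top_inf_eq] at h
  rw [← h]
  refine congrArg (joint f g) (Subtype.ext ?_)
  exact univ_prod

theorem integral_map₂ (φ : ℂ × ℂ → ℂ) (hφ : Continuous φ) (f g : LInfty X) :
    integral (map₂ φ hφ f g) = ∫ p, φ p ∂lawOf (joint f g) := by
  have : (map₂ φ hφ f g).law = (lawOf (joint f g)).map φ := lawOf_comp_preimage _ φ hφ.measurable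
  rw [integral, this]
  exact integral_map hφ.measurable.aemeasurable measurable_id.aestronglyMeasurable

theorem integral_add (f g : LInfty X) : integral (f + g) = integral f + integral g := by
  have hf : f.law = (lawOf (joint f g)).map Prod.fst := by
    rw [← lawOf_comp_preimage _ _ measurable_fst, ← hom_eq_joint_fst]; rfl
  have hg : g.law = (lawOf (joint f g)).map Prod.snd := by
    rw [← lawOf_comp_preimage _ _ measurable_snd, ← hom_eq_joint_snd]; rfl
  have hfi := integrable_law f
  have hgi := integrable_law g
  rw [hf] at hfi
  rw [hg] at hgi
  refine (integral_map₂ _ _ f g).trans ?_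
  rw [integral, integral, hf, hg,
    integral_map measurable_fst.aemeasurable (f := fun z : ℂ => z) measurable_id.aestronglyMeasurable,
    integral_map measurable_snd.aemeasurable (f := fun z : ℂ => z)
      measurable_id.aestronglyMeasurable]
  exact MeasureTheory.integral_add (hfi.comp_measurable measurable_fst)
    (hgi.comp_measurable measurable_snd)

theorem eq_zero_of_integral (d : LInfty X) (h : integral (d * star d) = 0) : d = 0 := by
  have h1 : d * star d = map (fun z => ((‖z‖ ^ 2 : ℝ) : ℂ)) (by fun_prop) d := ext_val (by
    filter_upwards [val_mul d (star d), val_star d,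
      val_map (fun z => ((‖z‖ ^ 2 : ℝ) : ℂ)) (by fun_prop) d] with w h1 h2 h3
    rw [h1, h2, h3, Complex.star_def, Complex.mul_conj, Complex.normSq_eq_norm_sq])
  have h2 : (map (fun z => ((‖z‖ ^ 2 : ℝ) : ℂ)) (by fun_prop) d).law =
      d.law.map (fun z => ((‖z‖ ^ 2 : ℝ) : ℂ)) :=
    lawOf_comp_preimage _ _ (by fun_prop)
  have hint := integrable_law (map (fun z => ((‖z‖ ^ 2 : ℝ) : ℂ)) (by fun_prop) d)
  rw [h2] at hint
  have hint' : Integrable (fun z : ℂ => ‖z‖ ^ 2) d.law :=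
    (hint.comp_measurable (by fun_prop)).re
  rw [h1, integral, h2, integral_map (by fun_prop) (f := fun z : ℂ => z)
      measurable_id.aestronglyMeasurable,
    integral_complex_ofReal, Complex.ofReal_eq_zero,
    integral_eq_zero_iff_of_nonneg (fun z => by positivity) hint'] at h
  have h3 : d.law ({0}ᶜ : Set ℂ) = 0 := by
    rw [← mem_ae_iff]
    filter_upwards [h] with z hz
    simpa using hz
  have h4 := lawOf_apply d.hom (⟨{0}, measurableSet_singleton 0⟩ : BorelC)ᶜ
  have h5 : X.μ (d.hom (⟨{0}, measurableSet_singleton 0⟩ : BorelC)ᶜ) = 0 :=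
    le_antisymm (ENNReal.ofReal_eq_zero.1 (h4.symm.trans h3)) (X.μ_nonneg _)
  have h6 : d.hom (⟨{0}, measurableSet_singleton 0⟩ : BorelC)ᶜ = ⊥ := by
    by_contra hne
    exact (X.μ_pos _ hne).ne' h5
  refine ext_val ?_
  filter_upwards [val_mem_iff d (⟨{0}, measurableSet_singleton 0⟩ : BorelC)ᶜ,
    val_zero (X := X)] with w hw hz
  rw [h6, map_bot] at hw
  rw [hz]
  by_contra hne
  exact hw.1 hne

/-- The Koopman operator preserves integrals. -/
theorem integral_koopman (π : X ⟶ Y) (f : LInfty Y) : integral (koopman π f) = integral f := by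
  have h : (koopman π f).law = f.law := by
    ext E hE
    refine (lawOf_apply _ ⟨E, hE⟩).trans (Eq.trans ?_ (lawOf_apply _ ⟨E, hE⟩).symm)
    exact congrArg ENNReal.ofReal (ProbAlg.Hom.measure_pull π _)
  rw [integral, h, integral]

/-- Conditional expectations are unique. -/
theorem IsCondExp.unique {π : X ⟶ Y} {f : LInfty X} {e e' : LInfty Y} (h : IsCondExp π f e)
    (h' : IsCondExp π f e') : e = e' := by
  have h1 : integral (e * star (e - e')) = integral (e' * star (e - e')) :=
    (h _).symm.trans (h' _)
  have h2 : e * star (e - e') = (e - e') * star (e - e') + e' * star (e - e') := by ring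
  rw [h2, integral_add] at h1
  exact sub_eq_zero.1 (eq_zero_of_integral _ (by simpa using h1))

end LInfty

open ProbabilityTheory
open Filter (Eventually Tendsto)
open scoped ENNReal Topology

/-! ### The concrete measure space of a probability algebra -/

/-! The product is the relatively independent coupling: draw a point of `Y`, then draw points of
`X₁` and `X₂` independently from the two conditional distributions over it. Granted a disintegration
of each `Xᵢ` over `Y`, the coupling is the mixture of the products of the fibre measures, and the
integral formula is Fubini in each fibre.

Abstract algebras have no points, so the two-valued homomorphisms of an algebra serve as points.
`GenericSpace` gives them the sigma-algebra of sets that generically agree with an element; its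
measure is complete and its null sets are exactly the generically empty ones (`ae_volume`). Abstract
functions thus become concrete measurable ones. `StoneSpace` has the same points but only the
sigma-algebra generated by the elements, so that a measure is determined by its values on elements
and the product is generated by cylinders.

No separability is assumed, so the disintegration cannot be built by discarding a null set for each
identity among conditional probabilities: there may be uncountably many. Instead `lift` chooses
representatives by limits along ultrafilters. It ignores null sets, is exactly additive at every
point, and changes a measurable function only on a null set (`lift_ae_eq`). At every point of `Y`
the lifted conditional probabilities form a finitely additive probability on `X`, which extends to a
measure because the Stone space is compact (`StoneSpace.exists_measure`). This gives `stoneKernel`.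

The measure algebra of the coupling is the relative product. Its projections are sigma-homomorphisms
since each marginal agrees with the generic measure, for which joins are unions almost everywhere
(`ae_basic_eq_iUnion`). They agree over `Y` since an event and its complement in `Y` have
conditional probabilities with product zero (`relMeasure_pull_compl`). The integral formula follows
from `lawOf_joint_relProd`. -/

/-- The two-valued homomorphisms on a probability algebra, as a concrete measure space. -/
abbrev GenericSpace (X : ProbAlg.{u}) : Type u := BoundedLatticeHom X Prop

namespace GenericSpace

variable {X Y : ProbAlg.{u}}

/-- A set is measurable if it is generically given by an element of the algebra. -/
instance (X : ProbAlg.{u}) : MeasurableSpace (GenericSpace X) where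
  MeasurableSet' D := ∃ a : X, ∀ᶠ w in genericFilter X, (w ∈ D ↔ w a)
  measurableSet_empty := ⟨⊥, Eventually.of_forall fun w => by rw [map_bot]; exact Iff.rfl⟩
  measurableSet_compl := by
    rintro D ⟨a, ha⟩
    refine ⟨aᶜ, ha.mono fun w hw => ?_⟩
    rw [ultra_compl, ← hw]
    rfl
  measurableSet_iUnion := by
    intro D h
    choose a ha using h
    obtain ⟨s, hs⟩ := X.sigmaComplete a
    refine ⟨s, ?_⟩
    filter_upwards [eventually_countable_forall.2 ha, eventually_isLUB hs] with w h1 h2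
    rw [h2, mem_iUnion]
    exact exists_congr h1

/-- The homomorphisms at which `a` is true. -/
def basic (a : X) : Set (GenericSpace X) := {w | w a}

theorem measurableSet_basic (a : X) : MeasurableSet (basic a) :=
  ⟨a, Eventually.of_forall fun _ => Iff.rfl⟩

/-- The identity is a function with values in the space itself, and by the choice of sigma-algebra
it pulls every measurable set back to an element. -/
theorem exists_element (X : ProbAlg.{u}) : ∃ J : SigmaHom (MeasSet (GenericSpace X)) X,
    ∀ D : MeasSet (GenericSpace X),
      ∀ᶠ w in genericFilter X, (w ∈ (D : Set (GenericSpace X)) ↔ w (J D)) := by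
  refine exists_hom_of_generic X.sigmaComplete (α := GenericSpace X) {D | MeasurableSet D}
    MeasurableSpace.generateFrom_measurableSet.symm (fun w => w) fun D hD => hD

/-- The element of the algebra that generically defines a measurable set. -/
noncomputable def element (X : ProbAlg.{u}) : SigmaHom (MeasSet (GenericSpace X)) X :=
  (exists_element X).choose

theorem eventually_element (D : MeasSet (GenericSpace X)) :
    ∀ᶠ w in genericFilter X, (w ∈ (D : Set (GenericSpace X)) ↔ w (element X D)) :=
  (exists_element X).choose_spec D

/-- The probability measure on the space of two-valued homomorphisms. -/
noncomputable instance (X : ProbAlg.{u}) : MeasureSpace (GenericSpace X) where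
  volume := LInfty.lawOf (element X)

instance (X : ProbAlg.{u}) : IsProbabilityMeasure (volume : Measure (GenericSpace X)) :=
  inferInstanceAs (IsProbabilityMeasure (LInfty.lawOf (element X)))

/-- An element is determined by its generic truth values, so any element representing `D`, not only
the chosen one, computes its measure. -/
theorem volume_of_eventually {D : Set (GenericSpace X)} {a : X}
    (h : ∀ᶠ w in genericFilter X, (w ∈ D ↔ w a)) :
    volume D = ENNReal.ofReal (X.μ a) := by
  have hD : MeasurableSet D := ⟨a, h⟩
  refine (LInfty.lawOf_apply (element X) ⟨D, hD⟩).trans ?_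
  congr 2
  refine eq_of_generic ?_
  filter_upwards [h, eventually_element ⟨D, hD⟩] with w h1 h2
  rw [← h1, ← h2]

theorem volume_basic (a : X) : volume (basic a) = ENNReal.ofReal (X.μ a) :=
  volume_of_eventually (Eventually.of_forall fun _ => Iff.rfl)

/-- Strict positivity of `X.μ` away from `⊥` forces a null measurable set to be represented by `⊥`,
that is, to be generically empty. -/
theorem ae_volume (X : ProbAlg.{u}) :
    ae (volume : Measure (GenericSpace X)) = genericFilter X := by
  have key : ∀ {D : Set (GenericSpace X)}, MeasurableSet D →
      (volume D = 0 ↔ ∀ᶠ w in genericFilter X, w ∉ D) := by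
    rintro D ⟨a, ha⟩
    rw [volume_of_eventually ha, ENNReal.ofReal_eq_zero]
    constructor
    · intro h
      have : a = ⊥ := by
        by_contra hne
        exact (X.μ_pos a hne).not_ge h
      subst this
      filter_upwards [ha] with w hw
      rw [hw, map_bot]
      exact id
    · intro h
      have : a = ⊥ := by
        refine eq_of_generic ?_
        filter_upwards [ha, h] with w h1 h2
        rw [← h1, map_bot]
        exact iff_of_false h2 id
      rw [this, X.μ_bot]
  ext S
  rw [mem_ae_iff]
  constructor
  · intro h
    obtain ⟨T, hST, hT, h0⟩ := exists_measurable_superset_of_null h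
    filter_upwards [(key hT).1 h0] with w hw
    by_contra hS
    exact hw (hST hS)
  · intro h
    -- `S` is arbitrary here: its complement is generically empty, hence represented by `⊥` and
    -- measurable.
    have hm : MeasurableSet Sᶜ := ⟨⊥, Filter.mem_of_superset h fun w hw => by
      change (w ∈ Sᶜ ↔ w ⊥)
      rw [map_bot]
      exact iff_of_false (fun h => h hw) id⟩
    exact (key hm).2 (Filter.mem_of_superset h fun w hw h => h hw)

theorem eventually_ae_iff {p : GenericSpace X → Prop} :
    (∀ᵐ w, p w) ↔ ∀ᶠ w in genericFilter X, p w := by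
  rw [ae_volume]

/-- Restriction of two-valued homomorphisms along a morphism of probability algebras. -/
noncomputable def comap (π : X ⟶ Y) (w : GenericSpace X) : GenericSpace Y :=
  ultraComap (ProbAlg.Hom.pull π) w

theorem comap_preimage_eventually (π : X ⟶ Y) {D : Set (GenericSpace Y)} {a : Y}
    (h : ∀ᶠ w in genericFilter Y, (w ∈ D ↔ w a)) :
    ∀ᶠ w in genericFilter X, (w ∈ comap π ⁻¹' D ↔ w (ProbAlg.Hom.pull π a)) :=
  (tendsto_ultraComap (ProbAlg.Hom.pull π)).eventually h

theorem measurable_comap (π : X ⟶ Y) : Measurable (comap π) := by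
  rintro D ⟨a, ha⟩
  exact ⟨_, comap_preimage_eventually π ha⟩

theorem map_comap_volume (π : X ⟶ Y) :
    (volume : Measure (GenericSpace X)).map (comap π) = volume := by
  ext D hD
  rw [Measure.map_apply (measurable_comap π) hD]
  obtain ⟨a, ha⟩ := hD
  rw [volume_of_eventually ha, volume_of_eventually (comap_preimage_eventually π ha),
    ProbAlg.Hom.measure_pull π a]

end GenericSpace

namespace LInfty

variable {X Y : ProbAlg.{u}}

/-- The values of a bounded abstract measurable function, as a concrete function. -/
noncomputable def fn (f : LInfty X) (w : GenericSpace X) : ℂ := f.val w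

theorem measurable_fn (f : LInfty X) : Measurable f.fn := fun E hE =>
  ⟨f.hom ⟨E, hE⟩, val_mem_iff f ⟨E, hE⟩⟩

theorem law_eq_map_fn (f : LInfty X) : f.law = volume.map f.fn := by
  ext E hE
  rw [Measure.map_apply f.measurable_fn hE]
  exact (lawOf_apply f.hom ⟨E, hE⟩).trans
    (GenericSpace.volume_of_eventually (val_mem_iff f ⟨E, hE⟩)).symm

theorem integral_eq (f : LInfty X) : integral f = ∫ w, f.fn w := by
  rw [integral, law_eq_map_fn]
  exact integral_map f.measurable_fn.aemeasurable measurable_id.aestronglyMeasurable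

theorem exists_fn_bound (f : LInfty X) : ∃ M : ℝ, ∀ᵐ w, ‖f.fn w‖ ≤ M := by
  obtain ⟨M, hM⟩ := f.bounded
  refine ⟨M, GenericSpace.eventually_ae_iff.2 ?_⟩
  filter_upwards [val_mem_iff f (closedBallC 0 M)] with w hw
  rw [hM, map_top] at hw
  exact mem_closedBall_zero_iff.1 (hw.2 trivial)

theorem fn_mul (f g : LInfty X) : ∀ᵐ w, (f * g).fn w = f.fn w * g.fn w :=
  GenericSpace.eventually_ae_iff.2 (val_mul f g)

/-- A bounded concrete measurable function defines an abstract one. -/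
theorem exists_fn_eq {g : GenericSpace X → ℂ} (hg : Measurable g) {M : ℝ}
    (hM : ∀ᵐ w, ‖g w‖ ≤ M) : ∃ f : LInfty X, f.fn =ᵐ[volume] g := by
  obtain ⟨J, hJ⟩ := exists_hom_of_generic X.sigmaComplete {E : Set ℂ | MeasurableSet E}
    MeasurableSpace.generateFrom_measurableSet.symm g fun E hE => hg hE
  refine ⟨⟨J, M, eq_of_generic ?_⟩, GenericSpace.eventually_ae_iff.2 (valueAt_eq hJ)⟩
  filter_upwards [hJ (closedBallC 0 M), GenericSpace.eventually_ae_iff.1 hM] with w h1 h2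
  rw [← h1, map_top]
  exact iff_of_true (mem_closedBall_zero_iff.2 h2) trivial

end LInfty

/-! ### Measures on the Stone space of a Boolean algebra -/

/-- The two-valued homomorphisms on a Boolean algebra, with the sigma-algebra generated by the
elements of the algebra. -/
def StoneSpace (A : Type*) [BooleanAlgebra A] : Type _ := BoundedLatticeHom A Prop

namespace StoneSpace

variable {A : Type*} [BooleanAlgebra A]

/-- The homomorphisms at which `a` is true. -/
def basic (a : A) : Set (StoneSpace A) := {w : BoundedLatticeHom A Prop | w a}

instance (A : Type*) [BooleanAlgebra A] : MeasurableSpace (StoneSpace A) :=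
  MeasurableSpace.generateFrom (range basic)

theorem measurableSet_basic (a : A) : MeasurableSet (basic a) :=
  MeasurableSpace.measurableSet_generateFrom ⟨a, rfl⟩

theorem basic_sup (a b : A) : basic (a ⊔ b) = basic a ∪ basic b := by
  ext w
  exact Iff.of_eq (map_sup (show BoundedLatticeHom A Prop from w) a b)

theorem basic_inf (a b : A) : basic (a ⊓ b) = basic a ∩ basic b := by
  ext w
  exact Iff.of_eq (map_inf (show BoundedLatticeHom A Prop from w) a b)

theorem basic_bot : basic (⊥ : A) = ∅ := by
  ext w
  exact Iff.of_eq (map_bot (show BoundedLatticeHom A Prop from w))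

theorem basic_top : basic (⊤ : A) = univ := by
  ext w
  exact Iff.of_eq (map_top (show BoundedLatticeHom A Prop from w))

theorem basic_compl (a : A) : basic aᶜ = (basic a)ᶜ := by
  ext w
  exact ultra_compl w a

theorem basic_injective : Function.Injective (basic : A → Set (StoneSpace A)) := fun _ _ h =>
  eq_of_generic (Eventually.of_forall fun w => Set.ext_iff.1 h w)

theorem isPiSystem_basic : IsPiSystem (range (basic : A → Set (StoneSpace A))) := by
  rintro _ ⟨a, rfl⟩ _ ⟨b, rfl⟩ -
  exact ⟨a ⊓ b, basic_inf a b⟩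

theorem isSetRing_basic : IsSetRing (range (basic : A → Set (StoneSpace A))) where
  empty_mem := ⟨⊥, basic_bot⟩
  union_mem := by
    rintro _ _ ⟨a, rfl⟩ ⟨b, rfl⟩
    exact ⟨a ⊔ b, basic_sup a b⟩
  sdiff_mem := by
    rintro _ _ ⟨a, rfl⟩ ⟨b, rfl⟩
    exact ⟨a ⊓ bᶜ, by rw [basic_inf, basic_compl, sdiff_eq]⟩

/-- Compactness of the Stone space. -/
theorem exists_eq_bot_of_iInter_basic_eq_empty {a : ℕ → A}
    (ha : Antitone fun n => basic (a n)) (h : ⋂ n, basic (a n) = ∅) : ∃ n, a n = ⊥ := by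
  by_contra! hne
  have ha' : Antitone a := fun m n hmn => by
    have := ha hmn
    rw [← inf_eq_left]
    refine basic_injective ?_
    rw [basic_inf]
    exact inter_eq_left.2 this
  -- A decreasing sequence of nonzero elements generates a proper filter; an ultrafilter above it is
  -- a point of the intersection.
  obtain ⟨w, hw⟩ := exists_ultra ha' hne
  exact notMem_empty (w : StoneSpace A) (h ▸ mem_iInter.2 hw)

/-- A finitely additive probability on a Boolean algebra is represented by a measure on the Stone
space. -/
theorem exists_measure (m : A → ℝ≥0∞) (h0 : m ⊥ = 0) (h1 : m ⊤ = 1)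
    (hadd : ∀ a b, a ⊓ b = ⊥ → m (a ⊔ b) = m a + m b) :
    ∃ μ : Measure (StoneSpace A), IsProbabilityMeasure μ ∧ ∀ a, μ (basic a) = m a := by
  -- Injectivity of `basic` makes `m` a well-defined function of the set `basic a`; the default
  -- value 0 is never met on the ring.
  have hext : ∀ a, Function.extend basic m 0 (basic a) = m a :=
    fun a => basic_injective.extend_apply m 0 a
  have hle : ∀ a, m a ≤ 1 := fun a => by
    rw [← h1, ← sup_compl_eq_top (x := a), hadd a aᶜ (inf_compl_self a)]
    exact le_self_add
  let c : AddContent ℝ≥0∞ (range (basic : A → Set (StoneSpace A))) :=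
    isSetRing_basic.addContent_of_union (Function.extend basic m 0)
      (by rw [← basic_bot, hext, h0])
      (by
        rintro _ _ ⟨a, rfl⟩ ⟨b, rfl⟩ hd
        rw [← basic_sup, hext, hext, hext]
        refine hadd a b (basic_injective ?_)
        rw [basic_inf, basic_bot]
        exact hd.inter_eq)
  have hc : ∀ a, c (basic a) = m a := hext
  have hsub : c.IsSigmaSubadditive := by
    refine isSigmaSubadditive_of_addContent_iUnion_eq_tsum isSetRing_basic fun f hf hU hd =>
      addContent_iUnion_eq_sum_of_tendsto_zero isSetRing_basic c ?_ ?_ hf hU hd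
    · rintro _ ⟨a, rfl⟩
      rw [hc]
      exact ((hle a).trans_lt ENNReal.one_lt_top).ne
    -- Continuity at `∅` is trivial: by compactness, a decreasing sequence of clopen sets with empty
    -- intersection is eventually empty.
    · intro s hs hanti hemp
      choose a ha using hs
      obtain rfl : (fun n => basic (a n)) = s := funext ha
      obtain ⟨N, hN⟩ := exists_eq_bot_of_iInter_basic_eq_empty hanti hemp
      refine tendsto_const_nhds.congr' ((Filter.eventually_ge_atTop N).mono fun n hn => ?_)
      have h2 : basic (a n) = basic ⊥ := by
        rw [basic_bot]
        refine subset_empty_iff.1 ((hanti hn).trans ?_)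
        change basic (a N) ⊆ ∅
        rw [hN, basic_bot]
      change 0 = c (basic (a n))
      rw [h2, hc, h0]
  have hμ : ∀ a, c.measure isSetRing_basic.isSetSemiring le_rfl hsub (basic a) = m a :=
    fun a => (c.measure_eq isSetRing_basic.isSetSemiring rfl hsub ⟨a, rfl⟩).trans (hc a)
  exact ⟨_, ⟨by rw [← basic_top, hμ, h1]⟩, hμ⟩

end StoneSpace

/-! ### Disintegration along a morphism of probability algebras -/

namespace GenericSpace

variable {X Y : ProbAlg.{u}}

/-- A null set is generically empty, so `⊥` represents it. Completeness is what makes lifted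
functions measurable. -/
instance : (volume : Measure (GenericSpace X)).IsComplete where
  out' s hs := ⟨⊥, by
    have h := eventually_ae_iff.1 (measure_eq_zero_iff_ae_notMem.1 hs)
    filter_upwards [h] with w hw
    rw [map_bot]
    exact iff_of_false hw id⟩

/-- The filter of sets that generically contain some element of the algebra true at `w`. -/
def localFilter (w : GenericSpace Y) : Filter (GenericSpace Y) where
  sets := {D | ∃ a : Y, w a ∧ ∀ᶠ v in genericFilter Y, v a → v ∈ D}
  univ_sets := ⟨⊤, by rw [map_top]; trivial, Eventually.of_forall fun _ _ => trivial⟩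
  sets_of_superset := by
    rintro S T ⟨a, ha, h⟩ hST
    exact ⟨a, ha, h.mono fun v hv hva => hST (hv hva)⟩
  inter_sets := by
    rintro S T ⟨a, ha, h⟩ ⟨b, hb, k⟩
    refine ⟨a ⊓ b, by rw [map_inf]; exact ⟨ha, hb⟩, ?_⟩
    filter_upwards [h, k] with v h1 h2 hv
    rw [map_inf] at hv
    exact ⟨h1 hv.1, h2 hv.2⟩

theorem mem_localFilter {w : GenericSpace Y} {D : Set (GenericSpace Y)} :
    D ∈ localFilter w ↔ ∃ a : Y, w a ∧ ∀ᶠ v in genericFilter Y, v a → v ∈ D := Iff.rfl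

theorem localFilter_le (w : GenericSpace Y) : localFilter w ≤ genericFilter Y := fun D hD =>
  mem_localFilter.2 ⟨⊤, by rw [map_top]; trivial, Filter.mem_of_superset hD fun _ hv _ => hv⟩

/-- An element that is generically false is `⊥`, which no homomorphism makes true. This holds at
every `w`, generic or not, so the lift is meaningful everywhere. -/
instance (w : GenericSpace Y) : (localFilter w).NeBot := by
  refine ⟨fun h => ?_⟩
  obtain ⟨a, ha, h⟩ := mem_localFilter.1 (Filter.empty_mem_iff_bot.2 h)
  have : a = ⊥ := eq_of_generic (h.mono fun v hv => by
    rw [map_bot]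
    exact iff_of_false hv id)
  rw [this, map_bot] at ha
  exact ha

/-- The limit of a function along an ultrafilter of sets that generically contain some element
true at `w`. -/
noncomputable def lift (g : GenericSpace Y → ℝ≥0∞) (w : GenericSpace Y) : ℝ≥0∞ :=
  ((Ultrafilter.of (localFilter w)).map g).lim

/-- The limit exists because `ℝ≥0∞` is compact. -/
theorem tendsto_lift (g : GenericSpace Y → ℝ≥0∞) (w : GenericSpace Y) :
    Tendsto g (Ultrafilter.of (localFilter w)) (𝓝 (lift g w)) :=
  ((Ultrafilter.of (localFilter w)).map g).le_nhds_lim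

theorem eventually_ultrafilter_of_ae {p : GenericSpace Y → Prop} (h : ∀ᵐ w, p w)
    (w : GenericSpace Y) : ∀ᶠ v in (Ultrafilter.of (localFilter w) : Filter (GenericSpace Y)),
      p v :=
  (Ultrafilter.of_le (localFilter w)).trans (localFilter_le w) (eventually_ae_iff.1 h)

/-- The ultrafilter refines the generic filter and so does not see null sets. Almost everywhere
identities thereby turn into identities at every point. -/
theorem lift_eq_of_tendsto {g h : GenericSpace Y → ℝ≥0∞} {w : GenericSpace Y} {c : ℝ≥0∞}
    (hgh : g =ᵐ[volume] h) (hc : Tendsto h (Ultrafilter.of (localFilter w)) (𝓝 c)) :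
    lift g w = c :=
  tendsto_nhds_unique ((tendsto_lift g w).congr' (eventually_ultrafilter_of_ae hgh w)) hc

/-- For each basic open `U`, the set `g ⁻¹' U` is represented by an element `a U`. At almost every
`w` the countably many equivalences `g w ∈ U ↔ w (a U)` hold together; then every basic
neighbourhood `U` of `g w` has `a U` true at `w`, so `g` tends to `g w` along the local filter. -/
theorem lift_ae_eq {g : GenericSpace Y → ℝ≥0∞} (hg : Measurable g) : lift g =ᵐ[volume] g := by
  have h : ∀ U ∈ TopologicalSpace.countableBasis ℝ≥0∞, ∃ a : Y,
      ∀ᶠ w in genericFilter Y, (g w ∈ U ↔ w a) := fun U hU =>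
    hg (TopologicalSpace.isOpen_of_mem_countableBasis hU).measurableSet
  choose! a ha using h
  refine eventually_ae_iff.2 ?_
  filter_upwards [(eventually_countable_ball
    (TopologicalSpace.countable_countableBasis ℝ≥0∞)).2 ha] with w hw
  refine lift_eq_of_tendsto (Filter.EventuallyEq.refl _ _)
    (Tendsto.mono_left ?_ (Ultrafilter.of_le (localFilter w)))
  rw [(TopologicalSpace.isBasis_countableBasis ℝ≥0∞).nhds_hasBasis.tendsto_right_iff]
  rintro U ⟨hU, hwU⟩
  exact mem_localFilter.2 ⟨a U, (hw U hU).1 hwU, (ha U hU).mono fun v hv => hv.2⟩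

/-- The conditional probability `E(1_a | Y)`. -/
noncomputable def condProb (π : X ⟶ Y) (a : X) : GenericSpace Y → ℝ≥0∞ :=
  ((volume.restrict (basic a)).map (comap π)).rnDeriv volume

theorem measurable_condProb (π : X ⟶ Y) (a : X) : Measurable (condProb π a) :=
  Measure.measurable_rnDeriv _ _

/-- Restricting to `basic a` only decreases the measure, and `comap π` preserves `volume`; hence the
image is absolutely continuous and its density integrates back to it. -/
theorem setLIntegral_condProb (π : X ⟶ Y) (a : X) {D : Set (GenericSpace Y)}
    (hD : MeasurableSet D) :
    ∫⁻ w in D, condProb π a w = volume (comap π ⁻¹' D ∩ basic a) := by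
  have hac : (volume.restrict (basic a)).map (comap π) ≪ volume := by
    have h := (Measure.absolutelyContinuous_of_le
      (Measure.restrict_le_self (μ := volume) (s := basic a))).map (measurable_comap π)
    rwa [map_comap_volume] at h
  rw [condProb, Measure.setLIntegral_rnDeriv hac, Measure.map_apply (measurable_comap π) hD,
    Measure.restrict_apply (measurable_comap π hD)]

theorem ae_eq_condProb {π : X ⟶ Y} {a : X} {g : GenericSpace Y → ℝ≥0∞} (hg : Measurable g)
    (h : ∀ D, MeasurableSet D → ∫⁻ w in D, g w = volume (comap π ⁻¹' D ∩ basic a)) :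
    g =ᵐ[volume] condProb π a :=
  ae_eq_of_forall_setLIntegral_eq_of_sigmaFinite hg (measurable_condProb π a) fun D hD _ => by
    rw [h D hD, setLIntegral_condProb π a hD]

theorem condProb_bot (π : X ⟶ Y) : condProb π ⊥ =ᵐ[volume] fun _ => 0 := by
  refine (ae_eq_condProb measurable_const fun D _ => ?_).symm
  have : basic (⊥ : X) = ∅ := StoneSpace.basic_bot
  simp [this]

theorem condProb_top (π : X ⟶ Y) : condProb π ⊤ =ᵐ[volume] fun _ => 1 := by
  refine (ae_eq_condProb measurable_const fun D hD => ?_).symm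
  have : basic (⊤ : X) = univ := StoneSpace.basic_top
  rw [this, inter_univ, ← Measure.map_apply (measurable_comap π) hD, map_comap_volume]
  simp

theorem condProb_sup (π : X ⟶ Y) {a b : X} (h : a ⊓ b = ⊥) :
    condProb π (a ⊔ b) =ᵐ[volume] fun w => condProb π a w + condProb π b w := by
  refine (ae_eq_condProb ((measurable_condProb π a).add (measurable_condProb π b))
    fun D hD => ?_).symm
  have h1 : basic (a ⊔ b) = basic a ∪ basic b := StoneSpace.basic_sup a b
  have h2 : basic a ∩ basic b = ∅ := by
    have : basic (a ⊓ b) = basic a ∩ basic b := StoneSpace.basic_inf a b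
    rw [← this, h]
    exact StoneSpace.basic_bot
  simp only [Pi.add_apply]
  rw [lintegral_add_left (measurable_condProb π a), setLIntegral_condProb π a hD,
    setLIntegral_condProb π b hD, h1, inter_union_distrib_left,
    measure_union ((disjoint_iff_inter_eq_empty.2 h2).mono inter_subset_right inter_subset_right)
      ((measurable_comap π hD).inter (measurableSet_basic b))]

/-- The event `basic (π.pull y)` is by definition the preimage of `basic y`, so it is already
decided by the point of `Y`. -/
theorem condProb_pull (π : X ⟶ Y) (y : Y) :
    condProb π (ProbAlg.Hom.pull π y) =ᵐ[volume] (basic y).indicator 1 := by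
  refine (ae_eq_condProb (measurable_one.indicator (measurableSet_basic y)) fun D hD => ?_).symm
  have h : basic (ProbAlg.Hom.pull π y) = comap π ⁻¹' basic y := rfl
  rw [h, ← preimage_inter, ← Measure.map_apply (measurable_comap π)
    (hD.inter (measurableSet_basic y)), map_comap_volume, lintegral_indicator_one
    (measurableSet_basic y), Measure.restrict_apply (measurableSet_basic y), inter_comm]

/-- The lift makes normalisation and finite additivity exact at each `w`, addition being continuous
on `ℝ≥0∞`; no exceptional set has to be removed. -/
theorem exists_measure_stoneSpace (π : X ⟶ Y) (w : GenericSpace Y) :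
    ∃ μ : Measure (StoneSpace X), IsProbabilityMeasure μ ∧
      ∀ a, μ (StoneSpace.basic a) = lift (condProb π a) w :=
  StoneSpace.exists_measure _
    (lift_eq_of_tendsto (condProb_bot π) tendsto_const_nhds)
    (lift_eq_of_tendsto (condProb_top π) tendsto_const_nhds)
    fun _ _ h => lift_eq_of_tendsto (condProb_sup π h) ((tendsto_lift _ w).add (tendsto_lift _ w))

/-- The disintegration of `X` over `Y`, with values in measures on the Stone space of `X`. -/
noncomputable def stoneKernel (π : X ⟶ Y) : Kernel (GenericSpace Y) (StoneSpace X) where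
  toFun w := (exists_measure_stoneSpace π w).choose
  measurable' := by
    have (w : GenericSpace Y) : IsProbabilityMeasure (exists_measure_stoneSpace π w).choose :=
      (exists_measure_stoneSpace π w).choose_spec.1
    refine Measurable.measure_of_isPiSystem_of_isProbabilityMeasure rfl
      StoneSpace.isPiSystem_basic ?_
    rintro _ ⟨a, rfl⟩
    simp only [(exists_measure_stoneSpace π _).choose_spec.2]
    -- The lift is only almost everywhere equal to a measurable function; completeness of `volume`
    -- is used here.
    exact (measurable_condProb π a).congr_ae (lift_ae_eq (measurable_condProb π a)).symm

instance (π : X ⟶ Y) : IsMarkovKernel (stoneKernel π) :=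
  ⟨fun w => (exists_measure_stoneSpace π w).choose_spec.1⟩

theorem stoneKernel_basic (π : X ⟶ Y) (a : X) :
    (fun w => stoneKernel π w (StoneSpace.basic a)) =ᵐ[volume] condProb π a := by
  filter_upwards [lift_ae_eq (measurable_condProb π a)] with w hw
  rw [← hw]
  exact (exists_measure_stoneSpace π w).choose_spec.2 a

end GenericSpace

/-! ### The measure algebra of a probability space -/

/-- Equality up to null sets. -/
def nullSetoid {T : Type*} [MeasurableSpace T] (ν : Measure T) : Setoid (MeasSet T) where
  r s t := (s : Set T) =ᵐ[ν] (t : Set T)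
  iseqv := ⟨fun _ => Filter.EventuallyEq.rfl, fun h => h.symm, fun h k => h.trans k⟩

/-- The measurable sets modulo null sets. -/
def MeasAlg {T : Type*} [MeasurableSpace T] (ν : Measure T) : Type _ := Quotient (nullSetoid ν)

namespace MeasAlg

variable {T : Type*} [MeasurableSpace T] {ν : Measure T}

/-- The class of a measurable set. -/
def mk (ν : Measure T) (s : MeasSet T) : MeasAlg ν := Quotient.mk (nullSetoid ν) s

theorem mk_surjective : Function.Surjective (mk ν) := Quotient.mk_surjective

theorem mk_eq_mk {s t : MeasSet T} : mk ν s = mk ν t ↔ (s : Set T) =ᵐ[ν] (t : Set T) :=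
  Quotient.eq (r := nullSetoid ν)

instance : LE (MeasAlg ν) where
  le := Quotient.lift₂ (fun s t => (s : Set T) ≤ᵐ[ν] (t : Set T)) fun _ _ _ _ h k =>
    propext ⟨fun l => h.symm.le.trans (l.trans k.le), fun l => h.le.trans (l.trans k.symm.le)⟩

theorem mk_le_mk {s t : MeasSet T} : mk ν s ≤ mk ν t ↔ (s : Set T) ≤ᵐ[ν] (t : Set T) := Iff.rfl

theorem mk_mono {s t : MeasSet T} (h : s ≤ t) : mk ν s ≤ mk ν t :=
  Filter.Eventually.of_forall fun _ hx => h hx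

instance : BooleanAlgebra (MeasAlg ν) where
  lt a b := a ≤ b ∧ ¬ b ≤ a
  le_refl := Quotient.ind fun _ => Filter.EventuallyLE.rfl
  le_trans := by
    rintro ⟨a⟩ ⟨b⟩ ⟨c⟩ h k
    exact Filter.EventuallyLE.trans h k
  le_antisymm := by
    rintro ⟨a⟩ ⟨b⟩ h k
    exact mk_eq_mk.2 (Filter.EventuallyLE.antisymm h k)
  sup := Quotient.map₂ (· ⊔ ·) fun _ _ h _ _ k => h.union k
  le_sup_left := by
    rintro ⟨a⟩ ⟨b⟩
    exact mk_mono le_sup_left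
  le_sup_right := by
    rintro ⟨a⟩ ⟨b⟩
    exact mk_mono le_sup_right
  sup_le := by
    rintro ⟨a⟩ ⟨b⟩ ⟨c⟩ h k
    filter_upwards [mk_le_mk.1 h, mk_le_mk.1 k] with x h1 h2
    exact fun hx => hx.elim h1 h2
  inf := Quotient.map₂ (· ⊓ ·) fun _ _ h _ _ k => h.inter k
  inf_le_left := by
    rintro ⟨a⟩ ⟨b⟩
    exact mk_mono inf_le_left
  inf_le_right := by
    rintro ⟨a⟩ ⟨b⟩
    exact mk_mono inf_le_right
  le_inf := by
    rintro ⟨a⟩ ⟨b⟩ ⟨c⟩ h k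
    filter_upwards [mk_le_mk.1 h, mk_le_mk.1 k] with x h1 h2
    exact fun hx => ⟨h1 hx, h2 hx⟩
  le_sup_inf := by
    rintro ⟨a⟩ ⟨b⟩ ⟨c⟩
    exact mk_mono le_sup_inf
  top := mk ν ⊤
  le_top := by
    rintro ⟨a⟩
    exact mk_mono le_top
  bot := mk ν ⊥
  bot_le := by
    rintro ⟨a⟩
    exact mk_mono bot_le
  compl := Quotient.map (·ᶜ) fun _ _ h => h.compl
  inf_compl_le_bot := by
    rintro ⟨a⟩
    exact mk_mono (inf_compl_self a).le
  top_le_sup_compl := by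
    rintro ⟨a⟩
    exact mk_mono (sup_compl_eq_top (x := a)).ge

/-- Equality up to null sets is all that is available for the images of joins under the projections.
Countability enters through `ae_all_iff`. -/
theorem isLUB_mk {E : ℕ → MeasSet T} {s : MeasSet T}
    (h : (s : Set T) =ᵐ[ν] ⋃ n, (E n : Set T)) : IsLUB (range fun n => mk ν (E n)) (mk ν s) := by
  refine ⟨?_, ?_⟩
  · rintro _ ⟨n, rfl⟩
    refine mk_le_mk.2 (Filter.EventuallyLE.trans ?_ h.symm.le)
    exact Filter.Eventually.of_forall fun x hx => mem_iUnion.2 ⟨n, hx⟩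
  · rintro ⟨b⟩ hb
    have hb' : ∀ᵐ x ∂ν, ∀ n, x ∈ (E n : Set T) → x ∈ (b : Set T) :=
      ae_all_iff.2 fun n => mk_le_mk.1 (hb ⟨n, rfl⟩)
    refine mk_le_mk.2 (h.le.trans ?_)
    filter_upwards [hb'] with x hx hxE
    obtain ⟨n, hn⟩ := mem_iUnion.1 hxE
    exact hx n hn

/-- The measure on the measure algebra. -/
noncomputable def measure (a : MeasAlg ν) : ℝ :=
  Quotient.lift (fun s : MeasSet T => ν.real (s : Set T)) (fun _ _ h => measureReal_congr h) a

theorem measure_mk (s : MeasSet T) : measure (mk ν s) = ν.real (s : Set T) := rfl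

end MeasAlg

/-- The probability algebra of a probability space. -/
noncomputable def ProbAlg.ofMeasure {T : Type u} [MeasurableSpace T] (ν : Measure T)
    [IsProbabilityMeasure ν] : ProbAlg.{u} where
  carrier := MeasAlg ν
  sigmaComplete E := by
    choose F hF using fun n => MeasAlg.mk_surjective (E n)
    obtain rfl : (fun n => MeasAlg.mk ν (F n)) = E := funext hF
    exact ⟨MeasAlg.mk ν ⟨⋃ n, (F n : Set T), MeasurableSet.iUnion fun n => (F n).2⟩,
      MeasAlg.isLUB_mk Filter.EventuallyEq.rfl⟩
  μ := MeasAlg.measure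
  μ_nonneg := by
    rintro ⟨s⟩
    exact measureReal_nonneg
  μ_bot := measureReal_empty
  μ_top := probReal_univ
  μ_isLUB E s hd hs := by
    choose F hF using fun n => MeasAlg.mk_surjective (E n)
    obtain rfl : (fun n => MeasAlg.mk ν (F n)) = E := funext hF
    have h := MeasAlg.isLUB_mk (ν := ν) (E := F)
      (s := ⟨⋃ n, (F n : Set T), MeasurableSet.iUnion fun n => (F n).2⟩) Filter.EventuallyEq.rfl
    rw [hs.unique h]
    simp only [MeasAlg.measure_mk]
    -- Disjointness in the algebra only says that the overlaps are null.
    have hd' : Pairwise (Function.onFun (AEDisjoint ν) fun n => (F n : Set T)) := fun m n hmn =>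
      (ae_eq_empty (μ := ν)).1 (MeasAlg.mk_eq_mk.1 (hd hmn))
    have hU := measure_iUnion₀ hd' fun n => (F n).2.nullMeasurableSet
    rw [measureReal_def, hU, ENNReal.tsum_toReal_eq fun n => measure_ne_top _ _]
    refine ENNReal.hasSum_toReal ?_
    rw [← hU]
    exact measure_ne_top _ _
  μ_pos := by
    rintro ⟨s⟩ hs
    refine measureReal_nonneg.lt_of_ne fun h => hs (MeasAlg.mk_eq_mk.2 ?_)
    exact ae_eq_empty.2 ((measureReal_eq_zero_iff (measure_ne_top _ _)).1 h.symm)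

/-- The only sigma-subalgebra of the measure algebra that contains a family of generators of the
sigma-algebra is the whole algebra. -/
theorem MeasAlg.eq_univ_of_generateFrom {T : Type*} [m : MeasurableSpace T] (ν : Measure T)
    {C : Set (Set T)} (hC : m = MeasurableSpace.generateFrom C) {S : Set (MeasAlg ν)}
    (hS : IsSigmaSubalgebra S) (h : ∀ s : MeasSet T, (s : Set T) ∈ C → MeasAlg.mk ν s ∈ S) :
    S = univ := by
  have key : ∀ s : MeasSet T, MeasAlg.mk ν s ∈ S := by
    rintro ⟨s, hs⟩
    subst hC
    let _ := MeasurableSpace.generateFrom C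
    induction s, hs using MeasurableSpace.generateFrom_induction with
    | hC t ht hm => exact h ⟨t, hm⟩ ht
    | empty => exact hS.bot_mem
    | compl t _ ih => exact hS.compl_mem _ ih
    | iUnion t ht ih =>
      exact hS.isLUB_mem _ _ ih (MeasAlg.isLUB_mk (E := fun n => ⟨t n, ht n⟩)
        Filter.EventuallyEq.rfl)
  refine eq_univ_of_forall fun a => ?_
  obtain ⟨s, rfl⟩ := MeasAlg.mk_surjective a
  exact key s

/-! ### Morphisms from measure algebras -/

namespace GenericSpace

variable {X Y : ProbAlg.{u}}

/-- The identity, as a map to the Stone space. -/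
def toStone (w : GenericSpace X) : StoneSpace X := w

theorem measurable_toStone : Measurable (toStone : GenericSpace X → StoneSpace X) := by
  refine measurable_generateFrom ?_
  rintro _ ⟨a, rfl⟩
  exact measurableSet_basic a

end GenericSpace

namespace ProbAlg

variable {T : Type u} [MeasurableSpace T] {X : ProbAlg.{u}}

/-- In the Stone space the clopen set of a join may be larger than the union of the clopen sets. The
image of `ν` agrees with the generic measure on the π-system of clopen sets, hence everywhere, and
generic homomorphisms preserve a given countable join, so the excess is null. -/
theorem ae_basic_eq_iUnion {ν : Measure T} [IsProbabilityMeasure ν] {p : T → StoneSpace X}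
    (hp : Measurable p) (h : ∀ a, ν (p ⁻¹' StoneSpace.basic a) = ENNReal.ofReal (X.μ a))
    {E : ℕ → X} {s : X} (hs : IsLUB (range E) s) :
    p ⁻¹' StoneSpace.basic s =ᵐ[ν] ⋃ n, p ⁻¹' StoneSpace.basic (E n) := by
  have hmap : ν.map p = volume.map GenericSpace.toStone := by
    have := Measure.isProbabilityMeasure_map (μ := ν) hp.aemeasurable
    refine ext_of_generate_finite _ rfl StoneSpace.isPiSystem_basic ?_ ?_
    · rintro _ ⟨a, rfl⟩
      rw [Measure.map_apply hp (StoneSpace.measurableSet_basic a),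
        Measure.map_apply GenericSpace.measurable_toStone (StoneSpace.measurableSet_basic a), h]
      exact (GenericSpace.volume_basic a).symm
    · rw [Measure.map_apply hp .univ, Measure.map_apply GenericSpace.measurable_toStone .univ]
      simp
  have hD : MeasurableSet {w | w ∈ StoneSpace.basic s ↔ ∃ n, w ∈ StoneSpace.basic (E n)} := by
    refine measurableSet_setOfPred.2 (Measurable.iff ?_ (Measurable.exists fun n => ?_))
    · exact measurableSet_setOfPred.1 (StoneSpace.measurableSet_basic s)
    · exact measurableSet_setOfPred.1 (StoneSpace.measurableSet_basic (E n))
  have hae : ∀ᵐ w ∂ν.map p, w ∈ StoneSpace.basic s ↔ ∃ n, w ∈ StoneSpace.basic (E n) := by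
    rw [hmap, ae_map_iff GenericSpace.measurable_toStone.aemeasurable hD]
    exact GenericSpace.eventually_ae_iff.2 (eventually_isLUB hs)
  refine Filter.eventuallyEq_set.2 ?_
  filter_upwards [ae_of_ae_map hp.aemeasurable hae] with x hx
  rw [mem_iUnion]
  exact hx

/-- A map to the Stone space of `X` with the right distribution gives a morphism to `X`. -/
noncomputable def ofStoneMap (ν : Measure T) [IsProbabilityMeasure ν] (p : T → StoneSpace X)
    (hp : Measurable p) (h : ∀ a, ν (p ⁻¹' StoneSpace.basic a) = ENNReal.ofReal (X.μ a)) :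
    ofMeasure ν ⟶ X where
  pull :=
    { toFun := fun a => MeasAlg.mk ν ⟨p ⁻¹' StoneSpace.basic a,
        hp (StoneSpace.measurableSet_basic a)⟩
      map_sup' := fun a b => congrArg (MeasAlg.mk ν) (Subtype.ext
        (congrArg (p ⁻¹' ·) (StoneSpace.basic_sup a b)))
      map_inf' := fun a b => congrArg (MeasAlg.mk ν) (Subtype.ext
        (congrArg (p ⁻¹' ·) (StoneSpace.basic_inf a b)))
      map_top' := congrArg (MeasAlg.mk ν) (Subtype.ext
        (congrArg (p ⁻¹' ·) StoneSpace.basic_top))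
      map_bot' := congrArg (MeasAlg.mk ν) (Subtype.ext
        (congrArg (p ⁻¹' ·) StoneSpace.basic_bot))
      map_isLUB' := fun _ _ hs => MeasAlg.isLUB_mk (ae_basic_eq_iUnion hp h hs) }
  measure_pull a := by
    refine (MeasAlg.measure_mk (ν := ν) _).trans ?_
    rw [measureReal_def, h, ENNReal.toReal_ofReal (X.μ_nonneg a)]

end ProbAlg

/-! ### Conditional expectations and conditional distributions -/

namespace LInfty

variable {X Y : ProbAlg.{u}}

/-- The conditional distribution of `f` over `Y`. -/
noncomputable def condLaw (π : X ⟶ Y) (f : LInfty X) : Kernel (GenericSpace Y) ℂ :=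
  condDistrib f.fn (GenericSpace.comap π) volume

instance (π : X ⟶ Y) (f : LInfty X) : IsMarkovKernel (condLaw π f) := by
  rw [condLaw]
  infer_instance

theorem compProd_condLaw (π : X ⟶ Y) (f : LInfty X) :
    volume ⊗ₘ condLaw π f = volume.map fun w => (GenericSpace.comap π w, f.fn w) := by
  have h := compProd_map_condDistrib (mβ := inferInstance) (X := GenericSpace.comap π)
    (μ := (volume : Measure (GenericSpace X))) f.measurable_fn.aemeasurable
  rwa [GenericSpace.map_comap_volume] at h

/-- This links the conditional distribution of `f` to the conditional probabilities that define the
coupling: both integrate over `D` to the measure of the same event, since `f.fn w ∈ E` is almost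
everywhere the truth of `f.hom E` at `w`. -/
theorem condLaw_apply (π : X ⟶ Y) (f : LInfty X) (E : BorelC) :
    (fun w => condLaw π f w (E : Set ℂ)) =ᵐ[volume] GenericSpace.condProb π (f.hom E) := by
  refine GenericSpace.ae_eq_condProb (Kernel.measurable_coe _ E.2) fun D hD => ?_
  have h1 := setLIntegral_preimage_condDistrib (μ := (volume : Measure (GenericSpace X)))
    (GenericSpace.measurable_comap π) f.measurable_fn.aemeasurable E.2 hD
  rw [← setLIntegral_map hD (Kernel.measurable_coe _ E.2) (GenericSpace.measurable_comap π),
    GenericSpace.map_comap_volume] at h1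
  refine h1.trans (measure_congr ?_)
  refine Filter.EventuallyEq.inter Filter.EventuallyEq.rfl (Filter.eventuallyEq_set.2 ?_)
  exact GenericSpace.eventually_ae_iff.2 (val_mem_iff f E)

/-- The conditional expectation is the mean of the conditional distribution, which exists as a
kernel because `ℂ` is standard Borel. The explicit formula is recorded for use in
`integral_relProd`. -/
theorem exists_isCondExp (π : X ⟶ Y) (f : LInfty X) : ∃ e : LInfty Y,
    e.fn =ᵐ[volume] (fun w => ∫ z, z ∂condLaw π f w) ∧ IsCondExp π f e := by
  have hmeas : Measurable fun w => (GenericSpace.comap π w, f.fn w) :=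
    (GenericSpace.measurable_comap π).prodMk f.measurable_fn
  obtain ⟨M, hM⟩ := f.exists_fn_bound
  -- Almost every conditional distribution is carried by the ball of radius `M`, so its mean is
  -- bounded by `M` as well.
  have hM' : ∀ᵐ p ∂(volume ⊗ₘ condLaw π f), ‖p.2‖ ≤ M := by
    rw [compProd_condLaw, ae_map_iff hmeas.aemeasurable
      (measurableSet_le measurable_snd.norm measurable_const)]
    exact hM
  obtain ⟨e, he⟩ := exists_fn_eq (X := Y) (g := fun w => ∫ z, z ∂condLaw π f w) (M := M)
    (stronglyMeasurable_id.integral_kernel).measurable (by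
      filter_upwards [Measure.ae_ae_of_ae_compProd hM'] with w hw
      simpa using norm_integral_le_of_norm_le_const hw)
  refine ⟨e, he, fun g => ?_⟩
  obtain ⟨N, hN⟩ := g.exists_fn_bound
  have hint : Integrable (fun p => p.2 * g.fn p.1) (volume ⊗ₘ condLaw π f) := by
    have hg : Measurable fun p : GenericSpace Y × ℂ => p.2 * g.fn p.1 :=
      measurable_snd.mul (g.measurable_fn.comp measurable_fst)
    rw [compProd_condLaw, integrable_map_measure hg.aestronglyMeasurable hmeas.aemeasurable]
    refine Integrable.of_bound (C := M * N) (hg.comp hmeas).aestronglyMeasurable ?_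
    have hN' : ∀ᵐ w, ‖g.fn (GenericSpace.comap π w)‖ ≤ N := by
      rw [← GenericSpace.map_comap_volume π] at hN
      exact ae_of_ae_map (GenericSpace.measurable_comap π).aemeasurable hN
    filter_upwards [hM, hN'] with w h1 h2
    rw [Function.comp_apply, norm_mul]
    exact mul_le_mul h1 h2 (norm_nonneg _) ((norm_nonneg _).trans h1)
  calc integral (f * koopman π g)
      = ∫ w, f.fn w * g.fn (GenericSpace.comap π w) := by
        rw [integral_eq]
        exact integral_congr_ae (fn_mul f (koopman π g))
    _ = ∫ p, p.2 * g.fn p.1 ∂(volume ⊗ₘ condLaw π f) := by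
        rw [compProd_condLaw, integral_map hmeas.aemeasurable]
        -- What remains is measurability of the integrand for the image measure, which `hint`
        -- contains.
        rw [← compProd_condLaw]
        exact hint.1
    _ = ∫ w, (∫ z, z ∂condLaw π f w) * g.fn w := by
        rw [Measure.integral_compProd hint]
        simp only [integral_mul_const]
    _ = integral (e * g) := by
        rw [integral_eq]
        refine integral_congr_ae ?_
        filter_upwards [he, fn_mul e g] with w h1 h2
        rw [h2, h1]

end LInfty

/-! ### The relative product -/

/-- The relatively independent coupling on the product of the Stone spaces. -/
noncomputable def relMeasure {X₁ X₂ Y : ProbAlg.{u}} (π₁ : X₁ ⟶ Y) (π₂ : X₂ ⟶ Y) :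
    Measure (StoneSpace X₁ × StoneSpace X₂) :=
  (GenericSpace.stoneKernel π₁ ×ₖ GenericSpace.stoneKernel π₂) ∘ₘ volume

section RelMeasure

variable {X₁ X₂ Y : ProbAlg.{u}} (π₁ : X₁ ⟶ Y) (π₂ : X₂ ⟶ Y)

instance : IsProbabilityMeasure (relMeasure π₁ π₂) := by
  rw [relMeasure]
  infer_instance

theorem relMeasure_prod (a : X₁) (b : X₂) :
    relMeasure π₁ π₂ (StoneSpace.basic a ×ˢ StoneSpace.basic b) =
      ∫⁻ w, GenericSpace.condProb π₁ a w * GenericSpace.condProb π₂ b w := by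
  rw [relMeasure, Measure.bind_apply ((StoneSpace.measurableSet_basic a).prod
    (StoneSpace.measurableSet_basic b)) (Kernel.aemeasurable _)]
  refine lintegral_congr_ae ?_
  filter_upwards [GenericSpace.stoneKernel_basic π₁ a, GenericSpace.stoneKernel_basic π₂ b]
    with w h1 h2
  rw [Kernel.prod_apply_prod, h1, h2]

theorem lintegral_condProb (a : X₁) :
    ∫⁻ w, GenericSpace.condProb π₁ a w = ENNReal.ofReal (X₁.μ a) := by
  have h := GenericSpace.setLIntegral_condProb π₁ a MeasurableSet.univ
  rwa [Measure.restrict_univ, preimage_univ, univ_inter, GenericSpace.volume_basic] at h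

theorem relMeasure_fst (a : X₁) :
    relMeasure π₁ π₂ (Prod.fst ⁻¹' StoneSpace.basic a) = ENNReal.ofReal (X₁.μ a) := by
  rw [← prod_univ, ← StoneSpace.basic_top, relMeasure_prod, ← lintegral_condProb π₁]
  refine lintegral_congr_ae ?_
  filter_upwards [GenericSpace.condProb_top π₂] with w hw
  rw [hw, mul_one]

theorem relMeasure_snd (b : X₂) :
    relMeasure π₁ π₂ (Prod.snd ⁻¹' StoneSpace.basic b) = ENNReal.ofReal (X₂.μ b) := by
  rw [← univ_prod, ← StoneSpace.basic_top, relMeasure_prod, ← lintegral_condProb π₂]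
  refine lintegral_congr_ae ?_
  filter_upwards [GenericSpace.condProb_top π₁] with w hw
  rw [hw, one_mul]

/-- The relative product of two probability algebras over a third. -/
noncomputable def relProd : ProbAlg.{u} := ProbAlg.ofMeasure (relMeasure π₁ π₂)

/-- The first projection. -/
noncomputable def relFst : relProd π₁ π₂ ⟶ X₁ :=
  ProbAlg.ofStoneMap (relMeasure π₁ π₂) Prod.fst measurable_fst (relMeasure_fst π₁ π₂)

/-- The second projection. -/
noncomputable def relSnd : relProd π₁ π₂ ⟶ X₂ :=
  ProbAlg.ofStoneMap (relMeasure π₁ π₂) Prod.snd measurable_snd (relMeasure_snd π₁ π₂)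

theorem relProd_μ_inf (a : X₁) (b : X₂) :
    ENNReal.ofReal ((relProd π₁ π₂).μ ((relFst π₁ π₂).pull a ⊓ (relSnd π₁ π₂).pull b)) =
      ∫⁻ w, GenericSpace.condProb π₁ a w * GenericSpace.condProb π₂ b w := by
  rw [← relMeasure_prod]
  exact ofReal_measureReal (measure_ne_top _ _)

/-- Both coordinates lie over the same point of `Y`: the two conditional probabilities are the
indicators of `y` and of its complement, with product zero. -/
theorem relMeasure_pull_compl (y : Y) : relMeasure π₁ π₂
    (StoneSpace.basic (π₁.pull y) ×ˢ StoneSpace.basic (π₂.pull yᶜ)) = 0 := by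
  rw [relMeasure_prod]
  refine (lintegral_eq_zero_iff ((GenericSpace.measurable_condProb π₁ _).mul
    (GenericSpace.measurable_condProb π₂ _))).2 ?_
  filter_upwards [GenericSpace.condProb_pull π₁ y, GenericSpace.condProb_pull π₂ yᶜ] with w h1 h2
  have h3 : GenericSpace.basic yᶜ = (GenericSpace.basic y)ᶜ := StoneSpace.basic_compl y
  rw [Pi.mul_apply, h1, h2, h3]
  by_cases hw : w ∈ GenericSpace.basic y <;> simp [hw]

/-- The symmetric difference of the two pulled back events is the union of two rectangles, which are
null by `relMeasure_pull_compl` for `y` and for `yᶜ`. -/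
theorem relFst_comp : relFst π₁ π₂ ≫ π₁ = relSnd π₁ π₂ ≫ π₂ := by
  refine ProbAlg.Hom.ext (SigmaHom.ext fun y => MeasAlg.mk_eq_mk.2 ?_)
  have h1 := measure_eq_zero_iff_ae_notMem.1 (relMeasure_pull_compl π₁ π₂ y)
  have h2 := measure_eq_zero_iff_ae_notMem.1 (relMeasure_pull_compl π₁ π₂ yᶜ)
  rw [compl_compl, map_compl'] at h2
  rw [map_compl'] at h1
  refine Filter.eventuallyEq_set.2 ?_
  filter_upwards [h1, h2] with p h1 h2
  rw [mem_prod, StoneSpace.basic_compl, mem_compl_iff] at h1 h2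
  change p.1 ∈ StoneSpace.basic (π₁.pull y) ↔ p.2 ∈ StoneSpace.basic (π₂.pull y)
  tauto

/-- Rectangles determine a finite measure on the product, and on a rectangle both sides are the
integral of a product of conditional probabilities, by `relProd_μ_inf` and `condLaw_apply`. -/
theorem lawOf_joint_relProd (f₁ : LInfty X₁) (f₂ : LInfty X₂) :
    LInfty.lawOf (LInfty.joint (LInfty.koopman (relFst π₁ π₂) f₁)
      (LInfty.koopman (relSnd π₁ π₂) f₂)) =
      (LInfty.condLaw π₁ f₁ ×ₖ LInfty.condLaw π₂ f₂) ∘ₘ volume := by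
  refine Measure.ext_prod fun {s t} hs ht => ?_
  rw [Measure.bind_apply (hs.prod ht) (Kernel.aemeasurable _)]
  refine (LInfty.lawOf_apply _ ⟨s ×ˢ t, hs.prod ht⟩).trans ?_
  rw [LInfty.joint_prod _ _ ⟨s, hs⟩ ⟨t, ht⟩]
  refine (relProd_μ_inf π₁ π₂ (f₁.hom ⟨s, hs⟩) (f₂.hom ⟨t, ht⟩)).trans (lintegral_congr_ae ?_)
  filter_upwards [LInfty.condLaw_apply π₁ f₁ ⟨s, hs⟩, LInfty.condLaw_apply π₂ f₂ ⟨t, ht⟩]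
    with w h1 h2
  rw [Kernel.prod_apply_prod, ← h1, ← h2]

/-- Given the point of `Y`, the two values are independent, so by Fubini the conditional mean of
their product is the product of the conditional means. -/
theorem integral_relProd {f₁ : LInfty X₁} {f₂ : LInfty X₂} {e₁ e₂ : LInfty Y}
    (he₁ : e₁.fn =ᵐ[volume] fun w => ∫ z, z ∂LInfty.condLaw π₁ f₁ w)
    (he₂ : e₂.fn =ᵐ[volume] fun w => ∫ z, z ∂LInfty.condLaw π₂ f₂ w) :
    LInfty.integral (LInfty.koopman (relFst π₁ π₂) f₁ * LInfty.koopman (relSnd π₁ π₂) f₂) =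
      LInfty.integral (e₁ * e₂) := by
  set F := LInfty.koopman (relFst π₁ π₂) f₁ with hF
  set G := LInfty.koopman (relSnd π₁ π₂) f₂ with hG
  have hlaw : (F * G).law = (LInfty.lawOf (LInfty.joint F G)).map fun p => p.1 * p.2 :=
    LInfty.lawOf_comp_preimage _ _ (by fun_prop)
  have hint : Integrable (fun p : ℂ × ℂ => p.1 * p.2) (LInfty.lawOf (LInfty.joint F G)) := by
    have h := LInfty.integrable_law (F * G)
    rw [hlaw] at h
    exact h.comp_measurable (by fun_prop)
  -- The mixture is rewritten as a composition with a constant kernel, the form to which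
  -- `Kernel.integral_comp` applies.
  rw [hF, hG, lawOf_joint_relProd, Measure.comp_eq_comp_const_apply] at hint
  refine (LInfty.integral_map₂ _ _ F G).trans ?_
  rw [hF, hG, lawOf_joint_relProd, Measure.comp_eq_comp_const_apply, Kernel.integral_comp hint,
    Kernel.const_apply, LInfty.integral_eq]
  refine integral_congr_ae ?_
  filter_upwards [he₁, he₂, LInfty.fn_mul e₁ e₂] with w h1 h2 h3
  rw [h3, h1, h2, Kernel.prod_apply]
  exact integral_prod_mul (fun z : ℂ => z) fun z : ℂ => z

/-- The product sigma-algebra of the Stone spaces is generated by the cylinders over elements, whose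
classes are exactly the values of the two pullbacks. -/
theorem relProd_generated {S : Set (relProd π₁ π₂)} (hS : IsSigmaSubalgebra S)
    (h1 : range (relFst π₁ π₂).pull ⊆ S) (h2 : range (relSnd π₁ π₂).pull ⊆ S) : S = univ := by
  have hgen : (inferInstance : MeasurableSpace (StoneSpace X₁ × StoneSpace X₂)) =
      MeasurableSpace.generateFrom (preimage Prod.fst '' range StoneSpace.basic ∪
        preimage Prod.snd '' range StoneSpace.basic) := by
    rw [← MeasurableSpace.generateFrom_sup_generateFrom, ← MeasurableSpace.comap_generateFrom,
      ← MeasurableSpace.comap_generateFrom]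
    rfl
  refine MeasAlg.eq_univ_of_generateFrom (relMeasure π₁ π₂) hgen hS ?_
  rintro ⟨s, hs⟩ (⟨_, ⟨a, rfl⟩, rfl⟩ | ⟨_, ⟨b, rfl⟩, rfl⟩)
  · exact h1 ⟨a, rfl⟩
  · exact h2 ⟨b, rfl⟩

end RelMeasure

theorem theorem7p1 {X₁ X₂ Y : ProbAlg.{u}} (π₁ : X₁ ⟶ Y) (π₂ : X₂ ⟶ Y) :
    ∃ (P : ProbAlg.{u}) (q₁ : P ⟶ X₁) (q₂ : P ⟶ X₂),
      q₁ ≫ π₁ = q₂ ≫ π₂ ∧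
      (LInfty.koopman q₁).comp (LInfty.koopman π₁) =
        (LInfty.koopman q₂).comp (LInfty.koopman π₂) ∧
      (∀ (f₁ : LInfty X₁) (f₂ : LInfty X₂), ∃ e₁ e₂ : LInfty Y,
        LInfty.IsCondExp π₁ f₁ e₁ ∧ LInfty.IsCondExp π₂ f₂ e₂ ∧
        LInfty.integral (LInfty.koopman q₁ f₁ * LInfty.koopman q₂ f₂) =
          LInfty.integral (e₁ * e₂)) ∧
      (∀ S : Set P, IsSigmaSubalgebra S → Set.range (ProbAlg.Hom.pull q₁) ⊆ S →
        Set.range (ProbAlg.Hom.pull q₂) ⊆ S → S = Set.univ) := by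
  refine ⟨relProd π₁ π₂, relFst π₁ π₂, relSnd π₁ π₂, relFst_comp π₁ π₂, ?_, fun f₁ f₂ => ?_,
    fun S hS h1 h2 => relProd_generated π₁ π₂ hS h1 h2⟩
  · refine DFunLike.ext _ _ fun f => ?_
    change LInfty.koopman (relFst π₁ π₂ ≫ π₁) f = LInfty.koopman (relSnd π₁ π₂ ≫ π₂) f
    rw [relFst_comp]
  · obtain ⟨e₁, h1, hc1⟩ := LInfty.exists_isCondExp π₁ f₁
    obtain ⟨e₂, h2, hc2⟩ := LInfty.exists_isCondExp π₂ f₂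
    exact ⟨e₁, e₂, hc1, hc2, integral_relProd π₁ π₂ h1 h2⟩
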